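/- Setting. Let $G=(V,E)$ be an undirected simple graph with $n\ge 1$ nodes and $m$ edges, given by adjacency lists, such that $n\le 2m$ (this holds, for instance, if $G$ has no isolated node). Let $h\ge 1$ be an integer, $0<\epsilon\le 1/2$, $C>0$, and $$M=1+\frac{4(2+\epsilon)}{\epsilon^{2}}\,(C+\log 8).$$ In a graph, $A(v)$ denotes the set of neighbours of $v$, and $N(v;i)$ the set of nodes reachable from $v$ by a path with at most $i$ edges. The algorithm Core approximates the distance-$h$ core decomposition. It samples independent ranks $r[v]$, geometric with parameter $1/2$ on $\{0,1,\dots\}$, so that $P(r[v]\ge k)=2^{-k}$. For every remaining node $v$ and $0\le i\le h$ it maintains, with respect to the current graph, the least level $k[v,i]\ge 0$ for which $B[v,i]=\{x\in N(v;i) : r[x]\ge k[v,i]\}$ has at most $M$ elements, and the set $B[v,i]$. It repeatedly removes a node $v$ that minimizes $$d[v]=\begin{cases}|B[v,h]\setminus\{v\}|, & k[v,h]=0,\\ \max\bigl(|B[v,h]\setminus\{v\}|\,2^{k[v,h]},\,M2^{k[v,h]-1}\bigr), & k[v,h]>0,\end{cases}$$ (ties are broken by smaller $k[v,h]$) and reports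 for it the largest value $d$ of a removed node so far, until the graph is empty. The refined version of Core maintains this data as follows. (1) $B[v,i]$ is a linked list sorted by decreasing rank. Each $x\in B[v,i]$ carries a counter, the number of $w\in A(v)$ with $x\in B[w,i-1]$, plus $1$ if $x=v$. Pointers link the copies of $x$ in the lists of adjacent nodes, so that a counter can be lowered, and the entry unlinked when its counter reaches $0$, in constant time. (2) $m[v,i]$ is the number of $w\in A(v)$ with $k[w,i-1]=k[v,i]$. (3) The procedure $\mathrm{Compute}(v,i)$ rebuilds $B[v,i]$ (together with $v$ itself, if its rank suffices) and $k[v,i]$ by successively merging the sorted lists $B[w,i-1]$, $w\in A(v)$, starting with the level $\max_{w\in A(v)}k[w,i-1]$ and raising the level and trimming whenever there are more than $M$ elements. It then recomputes $m[v,i]$ and a list $D[v,i]$ with counters: if $m[v,i]=0$, $D[v,i]$ consists of the nodes of rank $k[v,i]-1$ in $\{v\}\cup\bigcup_{w\in A(v)}B[w,i-1]$; otherwise it is empty. (4) Initially $\mathrm{Compute}(v,i)$ is called for all $v$ and all $i=1,\dots,h$. When $u$ is removed, rounds $i=0,\dots,h$ process a stack of pairs $(v,Y)$, where $Y$ is a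 set of nodes that have left $B[v,i]$; in each round the pair $(u,B[u,i])$ is on the stack, and $B[u,i]$ is emptied. To process $(v,Y)$: if $v\ne u$, $|B[v,i]|+|D[v,i]|\le M$ and $m[v,i]=0$, call $\mathrm{Compute}(v,i)$; if $v\ne u$ and $i=h$, re-evaluate $d[v]$; if $i<h$ and ($v=u$, or $Y\ne\emptyset$, or $k[v,i]$ has just changed), then for each remaining neighbour $w$ of $v$ lower the counters of the nodes of $Y$ in $B[w,i+1]$ and $D[w,i+1]$, lower $m[w,i+1]$ by one if $v=u$ or $k[v,i]$ has changed and the old $k[v,i]$ equals $k[w,i+1]$, and put $w$, with the set of nodes unlinked from $B[w,i+1]$, on the stack of round $i+1$. (5) The minimum of $d$ is found with a bucket queue whose integer keys order the nodes by $(k[v,h],\,|B[v,h]\setminus\{v\}|)$ lexicographically; this order refines the order by $d$ and then $k[\cdot,h]$. Running time is the number of unit-cost steps; sampling a rank, an arithmetic operation, a list or array access, and following a stored pointer each take constant time. Proposition 7. There is an absolute constant $K>0$ such that for all $G,h,\epsilon,C$ as above, each of the following two bounds holds with probability at least $1-ne^{-C}$: $$\text{running time of the refined Core}\ \le\ K\,h\,m\,M\,\max\Bigl(1,\log\frac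 nM\Bigr),$$ $$\text{running time of the refined Core}\ \le\ K\,h\,m\,C\epsilon^{-2}\max\Bigl(1,\log\frac{n\epsilon^{2}}{C}\Bigr).$$ Moreover, if $C\ge\log 2$, then each of the two quantities $h\,m\,M\max(1,\log\frac nM)$ and $h\,m\,C\epsilon^{-2}\max(1,\log\frac{n\epsilon^2}{C})$ is at most $K$ times the other. -/

import Mathlib

open MeasureTheory ProbabilityTheory

namespace DistCore

/-!
Conventions of the cost model.  The algorithm is written as a state transformer whose state carries
a step counter `time`.  Every unit of work of a unit-cost RAM is charged: reading or writing an
array cell, an arithmetic operation or a comparison (of integers or reals), sampling one rank, visiting one cell of a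
linked list, following one stored pointer, and unlinking a cell (of a doubly linked list) to which a
pointer is stored.  Only constantly many such operations are lumped into one step.  Lists in the
state are linked lists that store their own length.
-/

/-! ### Sorted lists of nodes with counters -/

/-- The order of the lists: decreasing rank, ties broken by the name of the node. -/
def Before {n : ℕ} (r : Fin n → ℕ) (x y : Fin n) : Prop := r y < r x ∨ (r x = r y ∧ x < y)

instance {n : ℕ} (r : Fin n → ℕ) (x y : Fin n) : Decidable (Before r x y) := by
  unfold Before; infer_instance

/-- `MergeSort(X, Y)`: merge the sorted counted list `X` with the sorted list `Y`; a node of `Y`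
adds `1` to its counter.  Returns the merged list and the number of steps (one per visited cell,
which includes setting the pointer of that cell). -/
def mergeSort {n : ℕ} (r : Fin n → ℕ) :
    List (Fin n × ℕ) → List (Fin n) → List (Fin n × ℕ) × ℕ
  | X, [] => (X, 1)
  | [], y :: Y => let p := mergeSort r [] Y; ((y, 1) :: p.1, p.2 + 1)
  | (x, a) :: X, y :: Y =>
    if x = y then
      let p := mergeSort r X Y; ((x, a + 1) :: p.1, p.2 + 1)
    else if Before r x y then
      let p := mergeSort r X (y :: Y); ((x, a) :: p.1, p.2 + 1)
    else
      let p := mergeSort r ((x, a) :: X) Y; ((y, 1) :: p.1, p.2 + 1)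
  termination_by X Y => X.length + Y.length

/-- Lower the counter of `y` by one and unlink `y` if the counter becomes `0` (nothing happens if
`y` is absent, i.e. its pointer is null).  The flag says whether `y` was unlinked.  The cell of `y`
is reached through the stored pointer, so the caller is charged one step. -/
def decr {n : ℕ} (y : Fin n) : List (Fin n × ℕ) → List (Fin n × ℕ) × Bool
  | [] => ([], false)
  | (x, a) :: X =>
    if x = y then
      if a ≤ 1 then (X, true) else ((x, a - 1) :: X, false)
    else let p := decr y X; ((x, a) :: p.1, p.2)

/-- `Delete(X, Y)`: lower the counters in `X` of the nodes in `Y`.  Returns the new list, the nodes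
that were unlinked, and the number of steps. -/
def delete {n : ℕ} : List (Fin n × ℕ) → List (Fin n) → List (Fin n × ℕ) × List (Fin n) × ℕ
  | X, [] => (X, [], 1)
  | X, y :: Y =>
    let a := decr y X
    let b := delete a.1 Y
    (b.1, if a.2 then y :: b.2.1 else b.2.1, b.2.2 + 1)

/-- Raise the counter of `u`, or append `u` with counter `1` if it is absent.  An array indexed by
the nodes holds the location of `u`, so the caller is charged one step. -/
def bump {n : ℕ} : List (Fin n × ℕ) → Fin n → List (Fin n × ℕ)
  | [], u => [(u, 1)]
  | (x, a) :: X, u => if x = u then (x, a + 1) :: X else (x, a) :: bump X u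

/-- `Union`: the nodes of `xs` with their multiplicities, with the number of steps: one for each
element of `xs`, and two for each element of the result (extraction, and clearing the array). -/
def union {n : ℕ} (xs : List (Fin n)) : List (Fin n × ℕ) × ℕ :=
  let D := xs.foldl bump []
  (D, 1 + xs.length + 2 * D.length)

/-! ### The input and the state -/

/-- The input: adjacency lists `adj`, the path length `h`, the buffer size `M`, and the sampled
ranks `r`. -/
structure Input (n : ℕ) where
  adj : Fin n → List (Fin n)
  h : ℕ
  M : ℝ
  r : Fin n → ℕ

/-- The variables of the algorithm.  `alive v` says that `v` has not yet been deleted from the graph.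
`B v i`, `k v i`, `m v i`, `D v i` are as in the algorithm, `d v` is the current estimate.  The
nodes are kept in a bucket queue: `bucket q` lists the remaining nodes with `key v = q`, and all
buckets below `ptr` are empty.  `c` is the running maximum, `core v` the reported core number, and
`time` the number of steps made so far. -/
structure State (n : ℕ) where
  alive : Fin n → Bool
  B : Fin n → ℕ → List (Fin n × ℕ)
  k : Fin n → ℕ → ℕ
  m : Fin n → ℕ → ℕ
  D : Fin n → ℕ → List (Fin n × ℕ)
  d : Fin n → ℝ
  key : Fin n → ℕ
  bucket : ℕ → List (Fin n)
  ptr : ℕ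
  c : ℝ
  core : Fin n → ℝ
  time : ℕ

/-- Write the value `a` to the cell `[v, i]`. -/
def set2 {n : ℕ} {α : Type} (f : Fin n → ℕ → α) (v : Fin n) (i : ℕ) (a : α) : Fin n → ℕ → α :=
  Function.update f v (Function.update (f v) i a)

/-- `⌊M⌋`; a list has at most `M` elements iff it has at most `⌊M⌋` elements. -/
noncomputable def Input.cap {n : ℕ} (P : Input n) : ℕ := ⌊P.M⌋₊

/-- The neighbours of `v` in the current graph. -/
def nbrs {n : ℕ} (P : Input n) (s : State n) (v : Fin n) : List (Fin n) :=
  (P.adj v).filter (fun w => s.alive w)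

/-! ### Compute -/

/-- One round of the merging loop of `Compute(v, i)`, for the neighbour `w`.  The accumulator is
`(T, k, steps)`. -/
noncomputable def mergeStep {n : ℕ} (P : Input n) (s : State n) (i : ℕ)
    (acc : List (Fin n × ℕ) × ℕ × ℕ) (w : Fin n) : List (Fin n × ℕ) × ℕ × ℕ :=
  let k := acc.2.1
  let Y := ((s.B w (i - 1)).map Prod.fst).filter (fun u => k ≤ P.r u)
  let p := mergeSort P.r acc.1 Y
  let T := p.1
  let steps := acc.2.2 + 1 + (s.B w (i - 1)).length + p.2 + T.length
  if hT : P.cap < T.length then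
    let k' := max k (P.r (T[P.cap]'hT).1 + 1)
    (T.filter (fun e => k' ≤ P.r e.1), k', steps)
  else (T, k, steps)

/-- The refined `Compute(v, i)`, `i ≥ 1`. -/
noncomputable def compute {n : ℕ} (P : Input n) (v : Fin n) (i : ℕ) (s : State n) : State n :=
  let A := nbrs P s v
  let k₀ := A.foldl (fun k w => max k (s.k w (i - 1))) 0
  let T₀ : List (Fin n × ℕ) := if k₀ ≤ P.r v then [(v, 1)] else []
  let res := A.foldl (mergeStep P s i) (T₀, k₀, 0)
  let T := res.1
  let k := res.2.1
  let m := (A.filter (fun w => s.k w (i - 1) = k)).length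
  let xs := (if P.r v + 1 = k then [v] else []) ++
    A.flatMap (fun w => ((s.B w (i - 1)).map Prod.fst).filter (fun u => P.r u + 1 = k))
  let scan := (A.map (fun w => 1 + (s.B w (i - 1)).length)).sum
  let U : List (Fin n × ℕ) × ℕ := if m = 0 then union xs else ([], 0)
  { s with
    B := set2 s.B v i T
    k := set2 s.k v i k
    m := set2 s.m v i m
    D := set2 s.D v i U.1
    time := s.time
      -- reading the neighbours and computing the maximum of their levels, and computing `m`
      + 1 + 2 * (P.adj v).length
      -- the merging loop
      + res.2.2
      -- finding the sets that are united, and the union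
      + scan + U.2
      -- the pointers from the lists of the neighbours into the new lists
      + scan
      -- the pointer arrays of the new list, one entry for each neighbour, copied where possible
      + (s.B v i).length + T.length * (1 + (P.adj v).length) }

/-! ### Estimate and the queue -/

/-- The estimate as a function of the level `k` and of `b = |B[v, h] ∖ {v}|`. -/
noncomputable def estimateVal (M : ℝ) (k b : ℕ) : ℝ :=
  if 0 < k then max ((b : ℝ) * 2 ^ k) (M * 2 ^ (k - 1)) else (b : ℝ) * 2 ^ k

/-- The key of a node in the bucket queue. -/
def keyVal (cap k b : ℕ) : ℕ := k * (cap + 1) + b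

/-- Nodes with the smallest key have the smallest estimate, with the level as a tie breaker. -/
theorem estimateVal_le_of_keyVal_le {M : ℝ} (hM : 0 ≤ M) {k₁ b₁ k₂ b₂ : ℕ}
    (hb₁ : b₁ ≤ ⌊M⌋₊) (hb₂ : b₂ ≤ ⌊M⌋₊) (h : keyVal ⌊M⌋₊ k₁ b₁ ≤ keyVal ⌊M⌋₊ k₂ b₂) :
    estimateVal M k₁ b₁ ≤ estimateVal M k₂ b₂ ∧ k₁ ≤ k₂ := by
  unfold keyVal at h
  have hk : k₁ ≤ k₂ := by
    by_contra hk
    have h1 : (k₂ + 1) * (⌊M⌋₊ + 1) ≤ k₁ * (⌊M⌋₊ + 1) := Nat.mul_le_mul_right _ (by omega)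
    have h2 : (k₂ + 1) * (⌊M⌋₊ + 1) = k₂ * (⌊M⌋₊ + 1) + ⌊M⌋₊ + 1 := by ring
    omega
  refine ⟨?_, hk⟩
  rcases hk.eq_or_lt with rfl | hlt
  · have hb : (b₁ : ℝ) ≤ b₂ := by exact_mod_cast (by omega : b₁ ≤ b₂)
    unfold estimateVal
    split_ifs <;> gcongr
  · have hbM : (b₁ : ℝ) ≤ M := (Nat.le_floor_iff hM).1 hb₁
    have e2 : M * 2 ^ (k₂ - 1) ≤ estimateVal M k₂ b₂ := by
      unfold estimateVal; rw [if_pos (by omega)]; exact le_max_right _ _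
    refine le_trans ?_ e2
    have h3 : (2 : ℝ) ^ k₁ ≤ 2 ^ (k₂ - 1) := pow_le_pow_right₀ (by norm_num) (by omega)
    have h4 : (b₁ : ℝ) * 2 ^ k₁ ≤ M * 2 ^ (k₂ - 1) := by gcongr
    unfold estimateVal
    split_ifs
    · refine max_le h4 ?_
      gcongr
      norm_num
    · exact h4

/-- The number of elements of `B[v, h] ∖ {v}`. -/
def others {n : ℕ} (P : Input n) (s : State n) (v : Fin n) : ℕ :=
  ((s.B v P.h).filter (fun e => e.1 ≠ v)).length

/-- `d[v] ← Estimate(v)`, and `v` is moved to its new bucket.  Constantly many steps: the number of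
elements is the stored length of `B[v, h]`, minus one if `r[v] ≥ k[v, h]`; and `v` is unlinked from
its old bucket through a stored pointer. -/
noncomputable def setEstimate {n : ℕ} (P : Input n) (v : Fin n) (s : State n) : State n :=
  let b := others P s v
  let q := keyVal P.cap (s.k v P.h) b
  let bk := Function.update s.bucket (s.key v) ((s.bucket (s.key v)).erase v)
  { s with
    d := Function.update s.d v (estimateVal P.M (s.k v P.h) b)
    bucket := Function.update bk q (v :: bk q)
    key := Function.update s.key v q
    ptr := min s.ptr q
    time := s.time + 1 }

/-! ### Update -/

/-- The innermost loop of `Update`, for the neighbour `w` of `v`: the nodes `Y`, which have left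
`B[v, i]`, are deleted from `B[w, i + 1]` and `D[w, i + 1]`; if the level of `v` is no longer the
old value `k` then `m[w, i + 1]` is corrected; `w` is added to the next stack with the nodes that
have left `B[w, i + 1]`. -/
def propagate {n : ℕ} (i : ℕ) (Y : List (Fin n)) (k : ℕ) (changed : Bool)
    (acc : State n × List (Fin n × List (Fin n))) (w : Fin n) :
    State n × List (Fin n × List (Fin n)) :=
  let s := acc.1
  let b := delete (s.B w (i + 1)) Y
  let e := delete (s.D w (i + 1)) Y
  ({ s with
      B := set2 s.B w (i + 1) b.1
      D := set2 s.D w (i + 1) e.1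
      m := if changed ∧ k = s.k w (i + 1) then set2 s.m w (i + 1) (s.m w (i + 1) - 1) else s.m
      time := s.time + 1 + b.2.2 + e.2.2 },
    (w, b.2.1) :: acc.2)

/-- Process the entry `(v, Y)` popped from the stack in round `i` of `Update(u)`.  The accumulator
is the state and the next stack. -/
noncomputable def processEntry {n : ℕ} (P : Input n) (u : Fin n) (i : ℕ)
    (acc : State n × List (Fin n × List (Fin n))) (e : Fin n × List (Fin n)) :
    State n × List (Fin n × List (Fin n)) :=
  let v := e.1
  let Y := e.2
  let s := acc.1
  let k := s.k v i
  let s := { s with time := s.time + 1 }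
  let s := if v ≠ u ∧ (s.B v i).length + (s.D v i).length ≤ P.cap ∧ s.m v i = 0
    then compute P v i s else s
  let s := if v ≠ u ∧ i = P.h then setEstimate P v s else s
  if i < P.h ∧ (v = u ∨ Y ≠ [] ∨ s.k v i ≠ k) then
    let s' := { s with time := s.time + (P.adj v).length }
    (nbrs P s' v).foldl (propagate i Y k (decide (v = u ∨ s.k v i ≠ k))) (s', acc.2)
  else (s, acc.2)

/-- Round `i` of `Update(u)`: the deleted node joins the stack with its whole list `B[u, i]`, and the
stack is emptied while the next one is built. -/
noncomputable def round {n : ℕ} (P : Input n) (u : Fin n)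
    (acc : State n × List (Fin n × List (Fin n))) (i : ℕ) :
    State n × List (Fin n × List (Fin n)) :=
  let s := acc.1
  let Y := (s.B u i).map Prod.fst
  let s := { s with
    B := set2 s.B u i []
    time := s.time + 1 + Y.length }
  ((u, Y) :: acc.2).foldl (processEntry P u i) (s, [])

/-- The refined `Update(u)`. -/
noncomputable def update {n : ℕ} (P : Input n) (u : Fin n) (s : State n) : State n :=
  let s := { s with
    alive := Function.update s.alive u false
    time := s.time + 1 }
  ((List.range (P.h + 1)).foldl (round P u) (s, [])).1

/-! ### Core -/

/-- Advance the queue pointer from `p` to the next non-empty bucket (`fuel` only bounds the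
recursion).  Returns the new pointer and the number of buckets inspected. -/
def advance {n : ℕ} (bucket : ℕ → List (Fin n)) : (fuel : ℕ) → ℕ → ℕ × ℕ
  | 0, p => (p, 0)
  | fuel + 1, p =>
    if bucket p = [] then let a := advance bucket fuel (p + 1); (a.1, a.2 + 1) else (p, 1)

/-- One iteration of the main loop: pick the node with the smallest estimate, report it, delete it. -/
noncomputable def coreStep {n : ℕ} (P : Input n) (s : State n) : State n :=
  let a := advance s.bucket (Finset.univ.sup s.key + 1) s.ptr
  match s.bucket a.1 with
  | [] => s
  | u :: rest =>
    let c := max s.c (s.d u)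
    update P u { s with
      bucket := Function.update s.bucket a.1 rest
      ptr := a.1
      c := c
      core := Function.update s.core u c
      time := s.time + 1 + a.2 }

/-- The state after reading the graph, sampling the ranks and setting `B[v, 0]` and `k[v, 0]`. -/
def start {n : ℕ} (P : Input n) : State n where
  alive := fun _ => true
  B := fun v i => if i = 0 then [(v, 1)] else []
  k := fun _ _ => 0
  m := fun _ _ => 0
  D := fun _ _ => []
  d := fun _ => 0
  key := fun _ => 0
  bucket := fun _ => []
  ptr := 0
  c := 0
  core := fun _ => 0
  time := 1 + ∑ v, (1 + (P.adj v).length)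

/-- The state before the main loop: all `Compute(v, i)` for `i = 1, …, h`, then the estimates. -/
noncomputable def initial {n : ℕ} (P : Input n) : State n :=
  let s := (List.range P.h).foldl
    (fun s i => (List.finRange n).foldl (fun s v => compute P v (i + 1) s) s) (start P)
  (List.finRange n).foldl (fun s v => setEstimate P v s) s

/-- The refined algorithm `Core`; every iteration deletes one node, so the graph is empty after `n`
iterations. -/
noncomputable def core {n : ℕ} (P : Input n) : State n := (coreStep P)^[n] (initial P)

/-! ### The quantities in the statement -/

/-- `adj` is an adjacency list representation of the graph `G`. -/
def IsAdjList {n : ℕ} (G : SimpleGraph (Fin n)) (adj : Fin n → List (Fin n)) : Prop :=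
  ∀ v, (adj v).Nodup ∧ ∀ w, w ∈ adj v ↔ G.Adj v w

/-- `M = 1 + 4 (2 + ε) / ε² (C + log 8)`. -/
noncomputable def buffer (ε C : ℝ) : ℝ := 1 + 4 * (2 + ε) / ε ^ 2 * (C + Real.log 8)

/-- The number of steps of `Core(G, ε, C)` when the sampled ranks are `r`. -/
noncomputable def coreTime {n : ℕ} (adj : Fin n → List (Fin n)) (h : ℕ) (ε C : ℝ)
    (r : Fin n → ℕ) : ℕ :=
  (core { adj := adj, h := h, M := buffer ε C, r := r }).time

/-- The law of the ranks: independent, geometric with parameter `1/2` on `{0, 1, …}`, so that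
`P(r[v] ≥ k) = 2⁻ᵏ`. -/
noncomputable def rankMeasure (n : ℕ) : Measure (Fin n → ℕ) :=
  Measure.pi fun _ => geometricMeasure ⟨1 / 2, by norm_num, by norm_num⟩

/-- `h m M log (n / M)`, the logarithm being at least `1`. -/
noncomputable def boundM (n m h : ℕ) (ε C : ℝ) : ℝ :=
  h * m * buffer ε C * max 1 (Real.log (n / buffer ε C))

/-- `h m C ε⁻² log (n ε² / C)`, the logarithm being at least `1`. -/
noncomputable def boundC (n m h : ℕ) (ε C : ℝ) : ℝ :=
  h * m * C * (ε ^ 2)⁻¹ * max 1 (Real.log (n * ε ^ 2 / C))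

end DistCore

namespace DistCore

variable {n : ℕ}

/-! ### Sorted lists with counters -/

/-! The argument splits into a deterministic amortized analysis for fixed ranks and one tail
estimate.

Deterministic part (`time_core_le`): let `κ` be such that at most `⌊M⌋` nodes have rank `≥ κ`, and
let `N = ⌊M⌋`. Every initial level is then at most `κ`, since `Compute` returns the least feasible
level. Each cell `(v, i)` carries a flag `g`, meaning that `D[v, i]` is in use, so `m[v, i] = 0`.
The central fact is that every call of `Compute` in the main loop lowers `2 k + [¬ g]`. If `g`
holds, `B` and `D` together contain all candidates of rank at least `k - 1`, so `|B| + |D| ≤ N`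
makes level `k - 1` feasible. If `g` fails, the level cannot rise, and if it stays the same then the
new `m` is `0` and `g` is switched on. Hence each cell is recomputed at most `2 κ + 1` times, at
cost `O(1 + N + deg v · N)`. Only `Compute` refills a list, and an unlinked entry is propagated at
cost `O(deg v)`; it pays from its share `8 deg v` of the potential. Moves of the queue pointer are
paid by decreases of the keys. Summing over cells gives `O(h m N (κ + 1))` steps.

The exception is a cell with `g` and `k = 0`, where `Compute` makes no progress. Such a cell has no
active neighbour, since a neighbour's level would be both at most and different from `0`. So no
neighbour can put it on the stack again, and a node without remaining neighbours occurs there at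
most once (`StackOk`).

The invariant `Inv` asks only for inequalities: counters and `m` must not be too small. This is all
that the running time needs; correctness of the output is not used. During an update, adjacent
layers are temporarily out of step. `CoupleAt` therefore compares layer `j + 1` with the levels of
layer `j` last communicated to it, and counts removed nodes still waiting on the stack as present.
The steps are `compute_step`, `setEstimate_step`, `propagate_step`, `processEntry_step`,
`round_step` and `coreStep_step`.

Probabilistic part: with `κ` minimal such that `n 2⁻ᵏ ≤ M / 4` at `k = κ`, Markov's inequality for
`2 ^ #{x | r x ≥ κ}` bounds the failure probability by `exp (M / 4 - M log 2) ≤ exp (-C)`, and `κ +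
1 = O(max 1 (log (n / M)))`. The second bound follows by comparing `M` with `C / ε²` if `C ≥ log 2`;
for smaller `C` the claimed probability is at most `0`. -/

theorem Before.trans {r : Fin n → ℕ} {x y z : Fin n} (h₁ : Before r x y) (h₂ : Before r y z) :
    Before r x z := by
  unfold Before at *; grind

theorem Before.total {r : Fin n → ℕ} {x y : Fin n} (h : x ≠ y) (h' : ¬ Before r x y) :
    Before r y x := by
  unfold Before at *; grind

theorem Before.ne {r : Fin n → ℕ} {x y : Fin n} (h : Before r x y) : x ≠ y := by
  rintro rfl; unfold Before at h; simp at h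

theorem Before.rank_le {r : Fin n → ℕ} {x y : Fin n} (h : Before r x y) : r y ≤ r x := by
  unfold Before at h; grind

/-- The nodes of a counted list. -/
def keys (X : List (Fin n × ℕ)) : List (Fin n) := X.map Prod.fst

@[simp] theorem keys_nil : keys ([] : List (Fin n × ℕ)) = [] := rfl

@[simp] theorem keys_cons (e : Fin n × ℕ) (X : List (Fin n × ℕ)) :
    keys (e :: X) = e.1 :: keys X := rfl

@[simp] theorem length_keys (X : List (Fin n × ℕ)) : (keys X).length = X.length := by
  simp [keys]

/-- The counter of `x` in a counted list (added up over all entries of `x`). -/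
def weight (x : Fin n) (X : List (Fin n × ℕ)) : ℕ := (X.map fun e => if e.1 = x then e.2 else 0).sum

@[simp] theorem weight_nil (x : Fin n) : weight x [] = 0 := rfl

@[simp] theorem weight_cons (x : Fin n) (e : Fin n × ℕ) (X : List (Fin n × ℕ)) :
    weight x (e :: X) = (if e.1 = x then e.2 else 0) + weight x X := by
  simp [weight]

theorem mem_keys_of_weight_pos {x : Fin n} {X : List (Fin n × ℕ)} (h : 0 < weight x X) :
    x ∈ keys X := by
  induction X with
  | nil => simp at h
  | cons e X ih =>
    rw [weight_cons] at h
    rw [keys_cons, List.mem_cons]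
    split_ifs at h with he
    · exact Or.inl he.symm
    · exact Or.inr (ih (by omega))

theorem weight_filter {x : Fin n} (p : Fin n → Prop) [DecidablePred p] (hx : p x)
    (X : List (Fin n × ℕ)) : weight x (X.filter fun e => p e.1) = weight x X := by
  induction X with
  | nil => rfl
  | cons e X ih =>
    rw [List.filter_cons]
    split_ifs with he
    · rw [weight_cons, weight_cons, ih]
    · rw [weight_cons, ih, if_neg]
      · simp
      · rintro rfl
        exact he (by simpa using hx)

theorem keys_filter (p : Fin n → Prop) [DecidablePred p] (X : List (Fin n × ℕ)) :
    keys (X.filter fun e => p e.1) = (keys X).filter (fun x => p x) := by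
  simp [keys, List.filter_map, Function.comp_def]

/-- The nodes are listed in the order `Before`. -/
def Ordered (r : Fin n → ℕ) (X : List (Fin n × ℕ)) : Prop := (keys X).Pairwise (Before r)

theorem Ordered.nodup {r : Fin n → ℕ} {X : List (Fin n × ℕ)} (h : Ordered r X) :
    (keys X).Nodup :=
  List.Pairwise.imp (fun h => h.ne) h

theorem Ordered.filter {r : Fin n → ℕ} {X : List (Fin n × ℕ)} (h : Ordered r X)
    (p : Fin n × ℕ → Bool) : Ordered r (X.filter p) :=
  List.Pairwise.sublist ((List.filter_sublist (p := p) (l := X)).map _) h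

/-! ### Merging -/

theorem weight_mergeSort (r : Fin n → ℕ) (x : Fin n) (X : List (Fin n × ℕ)) (Y : List (Fin n)) :
    weight x (mergeSort r X Y).1 = weight x X + Y.count x := by
  fun_induction mergeSort r X Y with
  | case1 => simp
  | case2 y Y p ih => simp only [weight_cons, List.count_cons]; grind
  | case3 x a X Y p ih => simp only [weight_cons, List.count_cons]; grind
  | case4 x a X y Y hxy hB p ih => simp only [weight_cons]; grind
  | case5 x a X y Y hxy hB p ih => simp only [weight_cons, List.count_cons] at *; grind

theorem mem_keys_mergeSort (r : Fin n → ℕ) (x : Fin n) (X : List (Fin n × ℕ)) (Y : List (Fin n)) :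
    x ∈ keys (mergeSort r X Y).1 ↔ x ∈ keys X ∨ x ∈ Y := by
  fun_induction mergeSort r X Y with
  | case1 => simp
  | case2 y Y p ih => simp only [keys_cons, List.mem_cons]; grind
  | case3 x a X Y p ih => simp only [keys_cons, List.mem_cons]; grind
  | case4 x a X y Y hxy hB p ih => simp only [keys_cons, List.mem_cons] at *; grind
  | case5 x a X y Y hxy hB p ih => simp only [keys_cons, List.mem_cons] at *; grind

theorem length_mergeSort_le (r : Fin n → ℕ) (X : List (Fin n × ℕ)) (Y : List (Fin n)) :
    (mergeSort r X Y).1.length ≤ X.length + Y.length := by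
  fun_induction mergeSort r X Y <;> grind

theorem steps_mergeSort_le (r : Fin n → ℕ) (X : List (Fin n × ℕ)) (Y : List (Fin n)) :
    (mergeSort r X Y).2 ≤ X.length + Y.length + 1 := by
  fun_induction mergeSort r X Y <;> grind

theorem ordered_mergeSort (r : Fin n → ℕ) (X : List (Fin n × ℕ)) (Y : List (Fin n))
    (hX : Ordered r X) (hY : Y.Pairwise (Before r)) : Ordered r (mergeSort r X Y).1 := by
  have hmem := mem_keys_mergeSort (n := n) r
  unfold Ordered at *
  fun_induction mergeSort r X Y with
  | case1 => exact hX
  | case2 y Y p ih =>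
    rw [keys_cons, List.pairwise_cons]
    rw [List.pairwise_cons] at hY
    exact ⟨fun z hz => hY.1 z (by simpa using (hmem z _ _).1 hz), ih hX hY.2⟩
  | case3 x a X Y p ih =>
    rw [keys_cons, List.pairwise_cons] at *
    refine ⟨fun z hz => ?_, ih hX.2 hY.2⟩
    rcases (hmem z _ _).1 hz with h | h
    · exact hX.1 z h
    · exact hY.1 z h
  | case4 x a X y Y hxy hB p ih =>
    rw [keys_cons, List.pairwise_cons] at hX ⊢
    refine ⟨fun z hz => ?_, ih hX.2 hY⟩
    rcases (hmem z _ _).1 hz with h | h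
    · exact hX.1 z h
    · rcases List.mem_cons.1 h with rfl | h
      · exact hB
      · exact hB.trans ((List.pairwise_cons.1 hY).1 z h)
  | case5 x a X y Y hxy hB p ih =>
    have hB' : Before r y x := Before.total hxy hB
    rw [keys_cons, List.pairwise_cons]
    refine ⟨fun z hz => ?_, ih hX (List.pairwise_cons.1 hY).2⟩
    rcases (hmem z _ _).1 hz with h | h
    · rw [keys_cons, List.mem_cons] at h
      rcases h with rfl | h
      · exact hB'
      · exact hB'.trans ((List.pairwise_cons.1 hX).1 z h)
    · exact (List.pairwise_cons.1 hY).1 z h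

/-! ### Deleting -/

/-- An entry is unlinked only when its counter is at most one, so at most one unit is lost; an
absent node loses nothing. Only this lower bound on counters enters the invariant. -/
theorem weight_decr (x y : Fin n) (X : List (Fin n × ℕ)) :
    weight x X ≤ weight x (decr y X).1 + if y = x then 1 else 0 := by
  induction X with
  | nil => simp [decr]
  | cons e X ih =>
    obtain ⟨z, a⟩ := e
    simp only [decr]
    split_ifs at * <;> simp only [weight_cons] at * <;> grind

theorem keys_decr (y : Fin n) (X : List (Fin n × ℕ)) :
    (keys X).Perm (keys (decr y X).1 ++ if (decr y X).2 then [y] else []) ∧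
      (keys (decr y X).1).Sublist (keys X) := by
  induction X with
  | nil => simp [decr]
  | cons e X ih =>
    obtain ⟨z, a⟩ := e
    by_cases h1 : z = y
    · subst h1
      by_cases h2 : a ≤ 1
      · simpa [decr, h2] using (List.perm_append_singleton z (keys X)).symm
      · simp [decr, h2]
    · simpa [decr, h1] using ih

theorem weight_delete (x : Fin n) (X : List (Fin n × ℕ)) (Y : List (Fin n)) :
    weight x X ≤ weight x (delete X Y).1 + Y.count x := by
  induction Y generalizing X with
  | nil => simp [delete]
  | cons y Y ih =>
    simp only [delete]
    have h1 := weight_decr x y X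
    have h2 := ih (decr y X).1
    rw [List.count_cons]
    by_cases hyx : y = x
    · simp [hyx] at *; omega
    · simp [hyx] at *; omega

theorem keys_delete (X : List (Fin n × ℕ)) (Y : List (Fin n)) :
    (keys X).Perm (keys (delete X Y).1 ++ (delete X Y).2.1) ∧
      (keys (delete X Y).1).Sublist (keys X) := by
  induction Y generalizing X with
  | nil => simp [delete]
  | cons y Y ih =>
    simp only [delete]
    obtain ⟨h1, h2⟩ := keys_decr y X
    obtain ⟨h3, h4⟩ := ih (decr y X).1
    refine ⟨?_, h4.trans h2⟩
    refine h1.trans ((h3.append_right _).trans ?_)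
    split_ifs
    · rw [List.append_assoc]
      exact List.Perm.append_left _ (List.perm_append_singleton _ _)
    · simp

theorem count_keys_delete (x : Fin n) (X : List (Fin n × ℕ)) (Y : List (Fin n)) :
    (keys (delete X Y).1).count x + (delete X Y).2.1.count x = (keys X).count x := by
  rw [(keys_delete X Y).1.count_eq, List.count_append]

theorem length_delete (X : List (Fin n × ℕ)) (Y : List (Fin n)) :
    (delete X Y).1.length + (delete X Y).2.1.length = X.length := by
  have := (keys_delete X Y).1.length_eq
  simp at this
  omega

theorem steps_delete (X : List (Fin n × ℕ)) (Y : List (Fin n)) :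
    (delete X Y).2.2 = Y.length + 1 := by
  induction Y generalizing X with
  | nil => simp [delete]
  | cons y Y ih => simp [delete, ih]

theorem Ordered.delete {r : Fin n → ℕ} {X : List (Fin n × ℕ)} (h : Ordered r X)
    (Y : List (Fin n)) : Ordered r (delete X Y).1 :=
  List.Pairwise.sublist (keys_delete X Y).2 h

/-! ### Uniting -/

theorem weight_bump (x u : Fin n) (X : List (Fin n × ℕ)) :
    weight x (bump X u) = weight x X + if u = x then 1 else 0 := by
  induction X with
  | nil => simp [bump]
  | cons e X ih =>
    obtain ⟨z, a⟩ := e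
    simp only [bump]
    split_ifs at * <;> simp only [weight_cons] at * <;> grind

theorem length_bump_le (u : Fin n) (X : List (Fin n × ℕ)) :
    (bump X u).length ≤ X.length + 1 := by
  induction X with
  | nil => simp [bump]
  | cons e X ih =>
    obtain ⟨z, a⟩ := e
    simp only [bump]
    split_ifs <;> grind

theorem weight_foldl_bump (x : Fin n) (xs : List (Fin n)) (X : List (Fin n × ℕ)) :
    weight x (xs.foldl bump X) = weight x X + xs.count x := by
  induction xs generalizing X with
  | nil => simp
  | cons y xs ih =>
    rw [List.foldl_cons, ih, weight_bump, List.count_cons]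
    simp only [beq_iff_eq]; omega

theorem length_foldl_bump_le (xs : List (Fin n)) (X : List (Fin n × ℕ)) :
    (xs.foldl bump X).length ≤ X.length + xs.length := by
  induction xs generalizing X with
  | nil => simp
  | cons y xs ih =>
    have := ih (bump X y)
    have := length_bump_le y X
    simp only [List.foldl_cons, List.length_cons]; omega

theorem weight_union (x : Fin n) (xs : List (Fin n)) : weight x (union xs).1 = xs.count x := by
  simp [union, weight_foldl_bump]

theorem steps_union_le (xs : List (Fin n)) : (union xs).2 ≤ 1 + 3 * xs.length := by
  have := length_foldl_bump_le xs []
  simp only [union, List.length_nil] at *; omega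

/-! ### The specification of `compute` -/

/-- What the merging loop of `Compute` guarantees after the lists `Z w`, `w ∈ A`, have been merged,
starting from level `k₀`. -/
structure MergeSpec (P : Input n) (v : Fin n) (k₀ : ℕ) (Z : Fin n → List (Fin n))
    (A : List (Fin n)) (T : List (Fin n × ℕ)) (k : ℕ) : Prop where
  ordered : Ordered P.r T
  length_le : T.length ≤ P.cap
  le_level : k₀ ≤ k
  level_le_rank : ∀ x ∈ keys T, k ≤ P.r x
  mem : ∀ x ∈ keys T, x = v ∨ ∃ w ∈ A, x ∈ Z w
  weight_eq : ∀ x, k ≤ P.r x →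
    weight x T = (if x = v then 1 else 0) + (A.map fun w => (Z w).count x).sum
  minimal : ∀ (κ : ℕ) (S : Finset (Fin n)), k₀ ≤ κ →
    (∀ x, κ ≤ P.r x → (x = v ∨ ∃ w ∈ A, x ∈ Z w) → x ∈ S) → S.card ≤ P.cap → k ≤ κ

/-- On overflow, the entry `z` at index `cap` is the first one too many. By the sorting, raising the
level to `r z + 1` discards `z` and all later entries. No smaller level is feasible, because the
`cap + 1` entries up to `z` would all be candidates for it. -/
theorem mergeStep_spec (P : Input n) (s : State n) (j : ℕ) (v : Fin n) (k₀ : ℕ)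
    (hord : ∀ w, Ordered P.r (s.B w j)) (hlen : ∀ w, (s.B w j).length ≤ P.cap)
    (A : List (Fin n)) (w : Fin n) (acc : List (Fin n × ℕ) × ℕ × ℕ)
    (h : MergeSpec P v k₀ (fun w => keys (s.B w j)) A acc.1 acc.2.1) :
    MergeSpec P v k₀ (fun w => keys (s.B w j)) (A ++ [w]) (mergeStep P s (j + 1) acc w).1
        (mergeStep P s (j + 1) acc w).2.1 ∧
      (mergeStep P s (j + 1) acc w).2.2 ≤ acc.2.2 + (5 * P.cap + 2) := by
  obtain ⟨T₀, k, c⟩ := acc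
  simp only at h
  set Y := (keys (s.B w j)).filter (fun u => k ≤ P.r u) with hY
  have hYlen : Y.length ≤ P.cap := by
    refine (List.length_filter_le _ _).trans ?_
    rw [length_keys]; exact hlen w
  set T := (mergeSort P.r T₀ Y).1 with hT
  have hTlen : T.length ≤ 2 * P.cap := by
    have h1 : T.length ≤ T₀.length + Y.length := length_mergeSort_le P.r T₀ Y
    have h2 := h.length_le
    omega
  have hsteps : c + 1 + (s.B w j).length + (mergeSort P.r T₀ Y).2 + T.length
      ≤ c + (5 * P.cap + 2) := by
    have h1 := steps_mergeSort_le P.r T₀ Y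
    have h2 := h.length_le
    have h3 := hlen w
    omega
  have hTord : Ordered P.r T :=
    ordered_mergeSort _ _ _ h.ordered (List.Pairwise.sublist List.filter_sublist (hord w))
  have hTmem : ∀ x ∈ keys T, k ≤ P.r x ∧ (x = v ∨ ∃ u ∈ A ++ [w], x ∈ keys (s.B u j)) := by
    intro x hx
    rcases (mem_keys_mergeSort _ _ _ _).1 hx with hx | hx
    · refine ⟨h.level_le_rank x hx, ?_⟩
      rcases h.mem x hx with h1 | ⟨u, hu, hxu⟩
      · exact Or.inl h1
      · exact Or.inr ⟨u, by simp [hu], hxu⟩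
    · rw [hY, List.mem_filter] at hx
      exact ⟨by simpa using hx.2, Or.inr ⟨w, by simp, hx.1⟩⟩
  have hTw : ∀ x, k ≤ P.r x → weight x T = (if x = v then 1 else 0) +
      ((A ++ [w]).map fun w => (keys (s.B w j)).count x).sum := by
    intro x hx
    rw [hT, weight_mergeSort, h.weight_eq x hx, hY, List.count_filter (by simpa using hx)]
    simp [add_assoc]
  have hmin : ∀ (κ : ℕ) (S : Finset (Fin n)), k₀ ≤ κ →
      (∀ x, κ ≤ P.r x → (x = v ∨ ∃ u ∈ A ++ [w], x ∈ keys (s.B u j)) → x ∈ S) →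
      S.card ≤ P.cap → k ≤ κ := by
    intro κ S h1 h2 h3
    refine h.minimal κ S h1 (fun x hx hc => h2 x hx ?_) h3
    rcases hc with hc | ⟨u, hu, hxu⟩
    · exact Or.inl hc
    · exact Or.inr ⟨u, by simp [hu], hxu⟩
  have key : mergeStep P s (j + 1) (T₀, k, c) w =
      if hT : P.cap < T.length then
        (T.filter (fun e => max k (P.r (T[P.cap]'hT).1 + 1) ≤ P.r e.1),
          max k (P.r (T[P.cap]'hT).1 + 1),
          c + 1 + (s.B w j).length + (mergeSort P.r T₀ Y).2 + T.length)
      else (T, k, c + 1 + (s.B w j).length + (mergeSort P.r T₀ Y).2 + T.length) := rfl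
  rw [key]
  by_cases hc : P.cap < T.length
  · rw [dif_pos hc]
    set z := (T[P.cap]'hc).1 with hz
    set k' := max k (P.r z + 1) with hk'
    have hkk' : k ≤ k' := le_max_left _ _
    have hzk : P.r z + 1 ≤ k' := le_max_right _ _
    have hord' : ∀ a b (ha : a < b) (hb : b < T.length),
        Before P.r (T[a]'(ha.trans hb)).1 (T[b]'hb).1 := by
      intro a b ha hb
      have := (List.pairwise_iff_getElem.1 hTord) a b (by simpa using ha.trans hb)
        (by simpa using hb) ha
      simpa [keys] using this
    refine ⟨⟨hTord.filter _, ?_, h.le_level.trans hkk', ?_, ?_, ?_, ?_⟩, hsteps⟩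
    · have h1 : T.filter (fun e => decide (k' ≤ P.r e.1)) =
          (T.take P.cap).filter (fun e => decide (k' ≤ P.r e.1)) := by
        conv_lhs => rw [← List.take_append_drop P.cap T, List.filter_append]
        have : (T.drop P.cap).filter (fun e => decide (k' ≤ P.r e.1)) = [] := by
          rw [List.filter_eq_nil_iff]
          intro e he
          obtain ⟨a, ha, rfl⟩ := List.getElem_of_mem he
          rw [List.getElem_drop]
          have ha' : P.cap + a < T.length := by
            rw [List.length_drop] at ha; omega
          have : P.r (T[P.cap + a]'ha').1 ≤ P.r z := by
            rcases Nat.eq_zero_or_pos a with rfl | hpos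
            · simp [hz]
            · exact (hord' P.cap (P.cap + a) (by omega) ha').rank_le
          simp only [decide_eq_true_eq, not_le]
          omega
        rw [this, List.append_nil]
      simp only [h1]
      exact (List.length_filter_le _ _).trans (by simp)
    · intro x hx
      simp only at hx ⊢
      rw [keys_filter (fun x => k' ≤ P.r x), List.mem_filter] at hx
      simpa using hx.2
    · intro x hx
      simp only at hx ⊢
      rw [keys_filter (fun x => k' ≤ P.r x), List.mem_filter] at hx
      exact (hTmem x hx.1).2
    · intro x hx
      simp only at hx ⊢
      rw [weight_filter (fun x => k' ≤ P.r x) hx]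
      exact hTw x (hkk'.trans hx)
    · intro κ S h1 h2 h3
      simp only
      by_contra hlt
      have hkκ : k ≤ κ := hmin κ S h1 h2 h3
      have hzκ : κ ≤ P.r z := by omega
      -- If `κ ≤ r z`, the first `cap + 1` entries all have rank at least `κ`, so `S` would contain
      -- more than `cap` nodes.
      have hsub : ((keys T).take (P.cap + 1)).toFinset ⊆ S := by
        intro x hx
        rw [List.mem_toFinset] at hx
        refine h2 x ?_ (hTmem x (List.mem_of_mem_take hx)).2
        obtain ⟨a, ha, rfl⟩ := List.getElem_of_mem hx
        have ha' : a < P.cap + 1 := by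
          rw [List.length_take] at ha; omega
        rw [List.getElem_take]
        simp only [keys, List.getElem_map]
        rcases Nat.lt_or_ge a P.cap with hlt | hge
        · exact hzκ.trans (hord' a P.cap hlt hc).rank_le
        · have : a = P.cap := by omega
          subst this
          exact hzκ
      have hcard := Finset.card_le_card hsub
      rw [List.toFinset_card_of_nodup (hTord.nodup.sublist (List.take_sublist _ _)),
        List.length_take, length_keys] at hcard
      omega
  · rw [dif_neg hc]
    refine ⟨⟨hTord, by simpa using hc, h.le_level, fun x hx => (hTmem x hx).1,
      fun x hx => (hTmem x hx).2, hTw, hmin⟩, hsteps⟩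

theorem mergeLoop_spec (P : Input n) (s : State n) (j : ℕ) (v : Fin n) (k₀ : ℕ)
    (hcap : 1 ≤ P.cap)
    (hord : ∀ w, Ordered P.r (s.B w j)) (hlen : ∀ w, (s.B w j).length ≤ P.cap)
    (A : List (Fin n)) :
    let res := A.foldl (mergeStep P s (j + 1)) (if k₀ ≤ P.r v then [(v, 1)] else [], k₀, 0)
    MergeSpec P v k₀ (fun w => keys (s.B w j)) A res.1 res.2.1 ∧
      res.2.2 ≤ A.length * (5 * P.cap + 2) := by
  induction A using List.reverseRecOn with
  | nil =>
    simp only [List.foldl_nil]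
    refine ⟨⟨?_, ?_, le_rfl, ?_, ?_, ?_, fun κ _ h _ _ => h⟩, by simp⟩
    · split_ifs <;> simp [Ordered]
    · split_ifs <;> simp [hcap]
    · intro x hx; split_ifs at hx <;> simp_all
    · intro x hx; split_ifs at hx <;> simp_all
    · intro x hx
      by_cases h : x = v
      · subst h; simp [hx]
      · split_ifs <;> simp [Ne.symm h]
  | append_singleton A w ih =>
    simp only [List.foldl_append, List.foldl_cons, List.foldl_nil]
    obtain ⟨h1, h2⟩ := ih
    obtain ⟨h3, h4⟩ := mergeStep_spec P s j v k₀ hord hlen A w _ h1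
    refine ⟨h3, h4.trans ?_⟩
    simp only [List.length_append, List.length_singleton]
    linarith

theorem foldl_max_spec (f : Fin n → ℕ) (A : List (Fin n)) (a : ℕ) :
    a ≤ A.foldl (fun k w => max k (f w)) a ∧ (∀ w ∈ A, f w ≤ A.foldl (fun k w => max k (f w)) a) ∧
      ∀ κ, a ≤ κ → (∀ w ∈ A, f w ≤ κ) → A.foldl (fun k w => max k (f w)) a ≤ κ := by
  induction A generalizing a with
  | nil => simp
  | cons w A ih =>
    obtain ⟨h1, h2, h3⟩ := ih (max a (f w))
    simp only [List.foldl_cons, List.mem_cons, forall_eq_or_imp]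
    exact ⟨(le_max_left _ _).trans h1, ⟨(le_max_right _ _).trans h1, h2⟩,
      fun κ ha h => h3 κ (max_le ha h.1) h.2⟩

/-- An upper bound for the number of steps of `Compute(v, i)` when `v` has `d` neighbours and lists
have at most `N` elements. -/
def computeCost (N d : ℕ) : ℕ := 5 + 2 * N + d * (6 + 11 * N)

/-- The list, level, counter and reserve list produced by `Compute` for a node `v` with the
remaining neighbours `A`, whose lists and levels are `Z` and `κ`. -/
structure ComputeSpec (P : Input n) (v : Fin n) (A : List (Fin n)) (Z : Fin n → List (Fin n))
    (lev : Fin n → ℕ) (T : List (Fin n × ℕ)) (k m : ℕ) (D : List (Fin n × ℕ)) : Prop where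
  ordered : Ordered P.r T
  length_le : T.length ≤ P.cap
  nbr_level_le : ∀ w ∈ A, lev w ≤ k
  level_le_rank : ∀ x ∈ keys T, k ≤ P.r x
  mem : ∀ x ∈ keys T, x = v ∨ ∃ w ∈ A, x ∈ Z w
  weight_eq : ∀ x, k ≤ P.r x →
    weight x T = (if x = v then 1 else 0) + (A.map fun w => (Z w).count x).sum
  minimal : ∀ (κ : ℕ) (S : Finset (Fin n)), (∀ w ∈ A, lev w ≤ κ) →
    (∀ x, κ ≤ P.r x → (x = v ∨ ∃ w ∈ A, x ∈ Z w) → x ∈ S) → S.card ≤ P.cap → k ≤ κ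
  m_eq : m = (A.filter fun w => lev w = k).length
  weight_reserve : m = 0 → ∀ x, P.r x + 1 = k →
    weight x D = (if x = v then 1 else 0) + (A.map fun w => (Z w).count x).sum

theorem length_flatMap_le {α β : Type*} (A : List α) (f : α → List β) (N : ℕ)
    (h : ∀ a ∈ A, (f a).length ≤ N) : (A.flatMap f).length ≤ A.length * N := by
  rw [List.length_flatMap]
  calc (A.map fun a => (f a).length).sum ≤ (A.map fun a => (f a).length).length • N :=
        List.sum_le_card_nsmul _ _ (by simpa using h)
    _ = A.length * N := by simp

theorem compute_spec (P : Input n) (s : State n) (j : ℕ) (v : Fin n) (hcap : 1 ≤ P.cap)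
    (hord : ∀ w, Ordered P.r (s.B w j)) (hlen : ∀ w, (s.B w j).length ≤ P.cap)
    (hlen' : (s.B v (j + 1)).length ≤ P.cap) :
    ∃ T k m D c, compute P v (j + 1) s = { s with
        B := set2 s.B v (j + 1) T
        k := set2 s.k v (j + 1) k
        m := set2 s.m v (j + 1) m
        D := set2 s.D v (j + 1) D
        time := s.time + c } ∧
      c ≤ computeCost P.cap (P.adj v).length ∧
      ComputeSpec P v (nbrs P s v) (fun w => keys (s.B w j)) (fun w => s.k w j) T k m D := by
  set A := nbrs P s v with hA
  have hAlen : A.length ≤ (P.adj v).length := List.length_filter_le _ _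
  set k₀ := A.foldl (fun k w => max k (s.k w j)) 0 with hk₀
  obtain ⟨-, hk₀A, hk₀min⟩ := foldl_max_spec (fun w => s.k w j) A 0
  obtain ⟨hM, hc⟩ := mergeLoop_spec P s j v k₀ hcap hord hlen A
  set res := A.foldl (mergeStep P s (j + 1)) (if k₀ ≤ P.r v then [(v, 1)] else [], k₀, 0) with hres
  set k := res.2.1 with hk
  set m := (A.filter (fun w => s.k w j = k)).length with hm
  set xs := (if P.r v + 1 = k then [v] else []) ++
    A.flatMap (fun w => (keys (s.B w j)).filter (fun u => P.r u + 1 = k)) with hxs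
  set scan := (A.map (fun w => 1 + (s.B w j).length)).sum with hscan
  set U : List (Fin n × ℕ) × ℕ := if m = 0 then union xs else ([], 0) with hU
  refine ⟨res.1, k, m, U.1, 1 + 2 * (P.adj v).length + res.2.2 + (scan + U.2) + scan +
    ((s.B v (j + 1)).length + res.1.length * (1 + (P.adj v).length)), ?_, ?_, ?_⟩
  · have : compute P v (j + 1) s = { s with
        B := set2 s.B v (j + 1) res.1
        k := set2 s.k v (j + 1) k
        m := set2 s.m v (j + 1) m
        D := set2 s.D v (j + 1) U.1
        time := s.time + 1 + 2 * (P.adj v).length + res.2.2 + scan + U.2 + scan +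
          (s.B v (j + 1)).length + res.1.length * (1 + (P.adj v).length) } := rfl
    rw [this]
    congr 1
    ring
  · have hscan' : scan ≤ A.length * (1 + P.cap) := by
      have := List.sum_le_card_nsmul (A.map (fun w => 1 + (s.B w j).length)) (1 + P.cap)
        (by simpa using fun w _ => hlen w)
      simpa only [List.length_map, smul_eq_mul] using this
    have hxs' : xs.length ≤ 1 + A.length * P.cap := by
      rw [hxs, List.length_append]
      refine add_le_add (by split_ifs <;> simp) (length_flatMap_le _ _ _ fun w _ => ?_)
      refine (List.length_filter_le _ _).trans ?_
      rw [length_keys]; exact hlen w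
    have hU' : U.2 ≤ 1 + 3 * (1 + A.length * P.cap) := by
      rw [hU]
      split_ifs
      · exact (steps_union_le xs).trans (by omega)
      · simp
    have hT := hM.length_le
    have h1 : A.length * P.cap ≤ (P.adj v).length * P.cap := Nat.mul_le_mul_right _ hAlen
    have h2 : res.1.length * (1 + (P.adj v).length) ≤ P.cap * (1 + (P.adj v).length) :=
      Nat.mul_le_mul_right _ hT
    -- The bounds for the merging loop, the two scans, the union and the pointer arrays add up to
    -- exactly this cost.
    unfold computeCost
    nlinarith
  · refine ⟨hM.ordered, hM.length_le, fun w hw => (hk₀A w hw).trans hM.le_level,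
      hM.level_le_rank, hM.mem, hM.weight_eq,
      fun κ S h1 h2 h3 => hM.minimal κ S (hk₀min κ (Nat.zero_le _) h1) h2 h3, rfl, ?_⟩
    intro hm0 x hx
    rw [hU, if_pos hm0, weight_union, hxs, List.count_append, List.count_flatMap]
    congr 1
    · by_cases hxv : x = v
      · subst hxv; simp [hx]
      · split_ifs <;> simp [Ne.symm hxv]
    · congr 1
      refine List.map_congr_left fun w _ => ?_
      simp only [Function.comp_apply]
      rw [List.count_filter (by simpa using hx)]

/-! ### Sums -/

theorem sum_map_add_le {α : Type*} (l : List α) (f' f : α → ℕ) (c : ℕ)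
    (hle : ∀ a ∈ l, f' a ≤ f a) (a₀ : α) (ha₀ : a₀ ∈ l) (h₀ : f' a₀ + c ≤ f a₀) :
    (l.map f').sum + c ≤ (l.map f).sum := by
  induction l with
  | nil => simp at ha₀
  | cons b l ih =>
    simp only [List.map_cons, List.sum_cons]
    rcases List.mem_cons.1 ha₀ with rfl | h
    · have := List.sum_le_sum (l := l) (f := f') (g := f) fun a ha => hle a (by simp [ha])
      omega
    · have h1 := ih (fun a ha => hle a (by simp [ha])) h
      have h2 := hle b (by simp)
      omega

theorem le_sum_map {α : Type*} (l : List α) (f : α → ℕ) {a : α} (ha : a ∈ l) :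
    f a ≤ (l.map f).sum :=
  List.le_sum_of_mem (List.mem_map_of_mem ha)

theorem sum_map_filter {α : Type*} (l : List α) (p : α → Bool) (f : α → ℕ) :
    ((l.filter p).map f).sum = (l.map fun a => if p a then f a else 0).sum := by
  induction l with
  | nil => rfl
  | cons a l ih => rw [List.filter_cons]; split_ifs <;> simp_all

theorem length_filter_eq_sum {α : Type*} (l : List α) (p : α → Bool) :
    (l.filter p).length = (l.map fun a => if p a then 1 else 0).sum := by
  induction l with
  | nil => rfl
  | cons a l ih => rw [List.filter_cons]; split_ifs <;> simp_all; omega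

/-- Compute, propagation to one neighbour and clearing a list each change the potential in a single
cell. The additive form avoids truncated subtraction. -/
theorem sum_cell_add_le {F' F : Fin n → ℕ → ℕ} {N a i₀ : ℕ} {v₀ : Fin n} (hi₀ : i₀ < N)
    (hne : ∀ v i, (v = v₀ → i ≠ i₀) → F' v i = F v i) (h₀ : F' v₀ i₀ + a ≤ F v₀ i₀) :
    ∑ v, ∑ i ∈ Finset.range N, F' v i + a ≤ ∑ v, ∑ i ∈ Finset.range N, F v i := by
  rw [← Finset.sum_product', ← Finset.sum_product']
  have hmem : (v₀, i₀) ∈ (Finset.univ : Finset (Fin n)) ×ˢ Finset.range N := by simp [hi₀]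
  rw [← Finset.add_sum_erase _ _ hmem, ← Finset.add_sum_erase _ _ hmem]
  have : ∑ x ∈ ((Finset.univ : Finset (Fin n)) ×ˢ Finset.range N).erase (v₀, i₀), F' x.1 x.2 =
      ∑ x ∈ ((Finset.univ : Finset (Fin n)) ×ˢ Finset.range N).erase (v₀, i₀), F x.1 x.2 := by
    refine Finset.sum_congr rfl fun x hx => hne _ _ fun h1 h2 => ?_
    rw [Finset.mem_erase] at hx
    exact hx.1 (Prod.ext h1 h2)
  rw [this]
  dsimp only
  omega

theorem set2_self {α : Type} (f : Fin n → ℕ → α) (v : Fin n) (i : ℕ) (a : α) :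
    set2 f v i a v i = a := by simp [set2]

theorem set2_of_ne {α : Type} (f : Fin n → ℕ → α) {v w : Fin n} {i j : ℕ} (a : α)
    (h : w = v → j ≠ i) : set2 f v i a w j = f w j := by
  by_cases hw : w = v
  · subst hw; simp [set2, h rfl]
  · simp [set2, hw]

/-! ### The coupling of the layers -/

/-- The number of times `w` contributes `x` to the lists of its neighbours: the occurrences in
`B[w, j]` and in the sets of removed nodes that wait on the stack. -/
def effCount (s : State n) (stk : List (Fin n × List (Fin n))) (j : ℕ) (w x : Fin n) : ℕ :=
  (keys (s.B w j)).count x + (stk.map fun e => if e.1 = w then e.2.count x else 0).sum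

/-- A lower bound for the counter that `x` has to have for the node `v`. -/
def demand (P : Input n) (E : Fin n → Fin n → ℕ) (v x : Fin n) : ℕ :=
  (if x = v then 1 else 0) + ((P.adj v).map fun w => E w x).sum

/-- The data `k`, `m`, `B`, `D` stored for `v` are large enough for the levels `lev`, the
contributions `E` and the set `act` of active neighbours.  The flag `g` says that `D` is in use. -/
structure CoupleAt (P : Input n) (lev : Fin n → ℕ) (E : Fin n → Fin n → ℕ) (act : Fin n → Bool)
    (v : Fin n) (k m : ℕ) (B D : List (Fin n × ℕ)) (g : Bool) : Prop where
  level_le : ∀ w ∈ P.adj v, act w → lev w ≤ k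
  count_le : ((P.adj v).map fun w => if act w ∧ lev w = k then 1 else 0).sum ≤ m
  demand_le : ∀ x, k ≤ P.r x → demand P E v x ≤ weight x B
  m_eq_zero : g → m = 0
  demand_le_reserve : g → ∀ x, P.r x + 1 = k → demand P E v x ≤ weight x D

theorem CoupleAt.level_ne {P : Input n} {lev : Fin n → ℕ} {E : Fin n → Fin n → ℕ}
    {act : Fin n → Bool} {v : Fin n} {k m : ℕ} {B D : List (Fin n × ℕ)} {g : Bool}
    (h : CoupleAt P lev E act v k m B D g) (hm : m = 0) {w : Fin n} (hw : w ∈ P.adj v)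
    (ha : act w) : lev w ≠ k := by
  intro he
  have h1 := le_sum_map (P.adj v) (fun w => if act w ∧ lev w = k then 1 else 0) hw
  have h2 := h.count_le
  simp only [ha, he, and_self, if_true] at h1
  omega

theorem demand_mono {P : Input n} {E E' : Fin n → Fin n → ℕ} {v x : Fin n}
    (h : ∀ w ∈ P.adj v, E' w x ≤ E w x) : demand P E' v x ≤ demand P E v x := by
  unfold demand
  exact Nat.add_le_add_left (List.sum_le_sum h) _

/-- Contributions may change as long as they do not grow at or above the level of the contributing
node. -/
theorem CoupleAt.of_effCount_le {P : Input n} {lev : Fin n → ℕ} {E E' : Fin n → Fin n → ℕ}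
    {act : Fin n → Bool} {v : Fin n} {k m : ℕ} {B D : List (Fin n × ℕ)} {g : Bool}
    (h : CoupleAt P lev E act v k m B D g)
    (hE : ∀ w ∈ P.adj v, (∀ x, E' w x ≤ E w x) ∨
      (act w ∧ ∀ x, lev w ≤ P.r x → E' w x ≤ E w x)) :
    CoupleAt P lev E' act v k m B D g := by
  refine ⟨h.level_le, h.count_le, fun x hx => ?_, h.m_eq_zero, fun hg x hx => ?_⟩
  · refine (demand_mono fun w hw => ?_).trans (h.demand_le x hx)
    rcases hE w hw with h1 | ⟨ha, h1⟩
    · exact h1 x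
    · exact h1 x ((h.level_le w hw ha).trans hx)
  · refine (demand_mono fun w hw => ?_).trans (h.demand_le_reserve hg x hx)
    rcases hE w hw with h1 | ⟨ha, h1⟩
    · exact h1 x
    -- Since `m = 0`, active neighbours have level at most `k - 1`, which is the rank of `x`; so the
    -- hypothesis on contributions also covers the reserve list.
    · refine h1 x ?_
      have h2 := h.level_le w hw ha
      have h3 := h.level_ne (h.m_eq_zero hg) hw ha
      omega

/-- The effect of processing `(v₀, Y)` on the data of a neighbour `v` of `v₀`. -/
theorem CoupleAt.delete {P : Input n} {lev lev' : Fin n → ℕ} {E E' : Fin n → Fin n → ℕ}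
    {act act' : Fin n → Bool} {v v₀ : Fin n} {k m m' : ℕ} {B D : List (Fin n × ℕ)} {g : Bool}
    {Y : List (Fin n)} {changed : Prop}
    (h : CoupleAt P lev E act v k m B D g) (hv₀ : v₀ ∈ P.adj v)
    (hlev : ∀ w, w ≠ v₀ → lev' w = lev w) (hact : ∀ w, w ≠ v₀ → act' w = act w)
    (hE : ∀ w, w ≠ v₀ → E' w = E w) (hE₀ : ∀ x, E' v₀ x + Y.count x ≤ E v₀ x)
    (hsame : ¬ changed → lev' v₀ = lev v₀ ∧ act' v₀ = act v₀) (hactive : act v₀)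
    (hchanged : changed → act' v₀ = false ∨ lev' v₀ < lev v₀)
    (hm : ¬ (changed ∧ lev v₀ = k) → m ≤ m') (hm' : m ≤ m' + 1) (hm'' : m' ≤ m) :
    CoupleAt P lev' E' act' v k m' (DistCore.delete B Y).1 (DistCore.delete D Y).1 g := by
  have hdem : ∀ x, demand P E' v x + Y.count x ≤ demand P E v x := by
    intro x
    unfold demand
    rw [add_assoc]
    refine Nat.add_le_add_left (sum_map_add_le _ _ _ _ (fun w _ => ?_) v₀ hv₀ (hE₀ x)) _
    by_cases hw : w = v₀
    · subst hw; have := hE₀ x; omega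
    · rw [hE w hw]
  have hlevle : act' v₀ → lev' v₀ ≤ lev v₀ := by
    intro ha
    by_cases hc : changed
    · rcases hchanged hc with h1 | h1
      · simp [h1] at ha
      · exact h1.le
    · exact (hsame hc).1.le
  have hle₀ := h.level_le v₀ hv₀ hactive
  refine ⟨fun w hw ha => ?_, ?_, fun x hx => ?_, fun hg => ?_, fun hg x hx => ?_⟩
  · by_cases hwv : w = v₀
    · subst hwv
      exact (hlevle ha).trans (h.level_le w hw hactive)
    · rw [hlev w hwv]; rw [hact w hwv] at ha
      exact h.level_le w hw ha
  · have hcnt := h.count_le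
    have hpt : ∀ w ∈ P.adj v, (if act' w ∧ lev' w = k then 1 else 0) ≤
        (if act w ∧ lev w = k then 1 else 0) := by
      intro w hw
      by_cases hwv : w = v₀
      · subst hwv
        by_cases hc : changed
        · rw [if_neg]
          · omega
          · rintro ⟨h1, h2⟩
            rcases hchanged hc with h3 | h3
            · simp [h3] at h1
            · omega
        · rw [(hsame hc).1, (hsame hc).2]
      · rw [hlev w hwv, hact w hwv]
    -- If `v₀` was counted in `m` and has changed, it is no longer counted, so the sum drops by the
    -- unit that `m'` may have lost. Otherwise `m` has not been lowered.
    by_cases hc : changed ∧ lev v₀ = k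
    · have h2 := sum_map_add_le _ _ _ 1 hpt v₀ hv₀ (by
        rw [if_neg, if_pos ⟨hactive, hc.2⟩]
        rintro ⟨h1, h2⟩
        rcases hchanged hc.1 with h3 | h3
        · simp [h3] at h1
        · have := hc.2; omega)
      omega
    · exact (List.sum_le_sum hpt).trans (hcnt.trans (hm hc))
  · have h1 := h.demand_le x hx
    have h2 := weight_delete x B Y
    have h3 := hdem x
    omega
  · have := h.m_eq_zero hg; omega
  · have h1 := h.demand_le_reserve hg x hx
    have h2 := weight_delete x D Y
    have h3 := hdem x
    omega

/-- The data produced by `Compute` fit the current graph. -/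
theorem ComputeSpec.coupleAt {P : Input n} {s : State n} {v : Fin n} {j : ℕ}
    {T D : List (Fin n × ℕ)} {k m : ℕ} {act : Fin n → Bool}
    (h : ComputeSpec P v (nbrs P s v) (fun w => keys (s.B w j)) (fun w => s.k w j) T k m D)
    (hact : ∀ w, act w = s.alive w) (hnil : ∀ w, ¬ act w → s.B w j = []) :
    CoupleAt P (fun w => s.k w j) (effCount s [] j) act v k m T D (decide (m = 0)) := by
  have hdem : ∀ x, demand P (effCount s [] j) v x =
      (if x = v then 1 else 0) +
        ((nbrs P s v).map fun w => (keys (s.B w j)).count x).sum := by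
    intro x
    unfold demand nbrs
    rw [sum_map_filter]
    congr 2
    refine List.map_congr_left fun w _ => ?_
    have := hnil w
    have := hact w
    by_cases ha : s.alive w <;> simp_all [effCount]
  refine ⟨fun w hw ha => h.nbr_level_le w ?_, ?_, fun x hx => ?_, by simp, fun hg x hx => ?_⟩
  · simp [nbrs, hw, ← hact, ha]
  · rw [h.m_eq, length_filter_eq_sum, nbrs, sum_map_filter]
    refine List.sum_le_sum fun w _ => ?_
    rw [hact w]
    by_cases ha : s.alive w <;> simp [ha]
  · rw [hdem, h.weight_eq x hx]
  · rw [hdem, h.weight_reserve (by simpa using hg) x hx]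

/-! ### Propagating deletions -/

/-- The neighbours are distinct, so the iterations touch disjoint cells and the loop has a closed
form. -/
theorem foldl_propagate (i : ℕ) (Y : List (Fin n)) (k : ℕ) (c : Bool) (L : List (Fin n))
    (hL : L.Nodup) (s : State n) (nxt : List (Fin n × List (Fin n))) :
    L.foldl (propagate i Y k c) (s, nxt) =
      ({ s with
          B := fun w j => if j = i + 1 ∧ w ∈ L then (delete (s.B w j) Y).1 else s.B w j
          D := fun w j => if j = i + 1 ∧ w ∈ L then (delete (s.D w j) Y).1 else s.D w j
          m := fun w j => if (j = i + 1 ∧ w ∈ L) ∧ c ∧ k = s.k w j then s.m w j - 1 else s.m w j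
          time := s.time + L.length * (2 * Y.length + 3) },
        (L.map fun w => (w, (delete (s.B w (i + 1)) Y).2.1)).reverse ++ nxt) := by
  induction L generalizing s nxt with
  | nil => simp
  | cons a L ih =>
    rw [List.nodup_cons] at hL
    rw [List.foldl_cons, propagate, ih hL.2]
    have hne : ∀ w ∈ L, w ≠ a := fun w hw h => hL.1 (h ▸ hw)
    refine Prod.ext ?_ ?_
    · simp only [State.mk.injEq, true_and]
      refine ⟨?_, ?_, ?_, ?_⟩
      · funext w j
        by_cases hw : w = a
        · subst hw
          by_cases hj : j = i + 1
          · subst hj; simp [hL.1, set2_self]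
          · simp [hj, set2_of_ne]
        · rw [set2_of_ne _ _ (fun h => absurd h hw)]
          simp [hw]
      · funext w j
        by_cases hw : w = a
        · subst hw
          by_cases hj : j = i + 1
          · subst hj
            by_cases hc : (c : Prop) ∧ k = s.k w (i + 1)
            · simp [hc.1, hc.2, hL.1, set2_self]
            · simp [hL.1, hc]
          · by_cases hc : (c : Prop) ∧ k = s.k w (i + 1)
            · simp [hj, hc.1, hc.2, set2_of_ne]
            · simp [hj, hc]
        · by_cases hc : (c : Prop) ∧ k = s.k a (i + 1)
          · simp only [hc, and_self, if_true, set2_of_ne _ _ (fun h => absurd h hw)]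
            simp [hw]
          · rw [if_neg hc]
            simp [hw]
      · funext w j
        by_cases hw : w = a
        · subst hw
          by_cases hj : j = i + 1
          · subst hj; simp [hL.1, set2_self]
          · simp [hj, set2_of_ne]
        · rw [set2_of_ne _ _ (fun h => absurd h hw)]
          simp [hw]
      · simp only [steps_delete, List.length_cons]; ring
    · simp only [List.map_cons, List.reverse_cons, List.append_assoc, List.singleton_append]
      congr 2
      refine List.map_congr_left fun w hw => ?_
      rw [set2_of_ne _ _ (fun h => absurd h (hne w hw))]

/-! ### The invariant -/

/-- The requirements on the input: the adjacency lists are those of an undirected simple graph, and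
`M ≥ 1`. -/
structure Input.Valid (P : Input n) : Prop where
  symm : ∀ v w, w ∈ P.adj v → v ∈ P.adj w
  nodup : ∀ v, (P.adj v).Nodup
  one_le_cap : 1 ≤ P.cap

/-- The bucket queue is consistent, its keys are at least the current ones, and at most `Q`. -/
structure QueueInv (P : Input n) (s : State n) (Q : ℕ) : Prop where
  mem_bucket : ∀ v, s.alive v → v ∈ s.bucket (s.key v)
  of_mem_bucket : ∀ q v, v ∈ s.bucket q → s.alive v ∧ s.key v = q
  nodup : ∀ q, (s.bucket q).Nodup
  ptr_le_key : ∀ v, s.alive v → s.ptr ≤ s.key v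
  keyVal_le : ∀ v, s.alive v → keyVal P.cap (s.k v P.h) (others P s v) ≤ s.key v
  key_le : ∀ v, s.alive v → s.key v ≤ Q
  ptr_le : s.ptr ≤ Q

/-- The invariant of the algorithm.  `g v i` says that `D[v, i]` is in use, `act j w` that `w` still
counts as a neighbour in layer `j`, `stk j` is the stack of round `j`, and `lev j` are the levels
that layer `j + 1` knows of. -/
structure Inv (P : Input n) (Q : ℕ) (s : State n) (g : Fin n → ℕ → Bool) (act : ℕ → Fin n → Bool)
    (stk : ℕ → List (Fin n × List (Fin n))) (lev : ℕ → Fin n → ℕ) : Prop where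
  ordered : ∀ v i, Ordered P.r (s.B v i)
  length_le : ∀ v i, (s.B v i).length ≤ P.cap
  eq_nil : ∀ j < P.h, ∀ w, act j w = false → s.B w j = []
  couple : ∀ j < P.h, ∀ v, s.alive v → CoupleAt P (lev j) (effCount s (stk j) j) (act j) v
    (s.k v (j + 1)) (s.m v (j + 1)) (s.B v (j + 1)) (s.D v (j + 1)) (g v (j + 1))
  queue : QueueInv P s Q

theorem QueueInv.addTime {P : Input n} {Q : ℕ} {s : State n} (h : QueueInv P s Q) (t : ℕ) :
    QueueInv P { s with time := t } Q :=
  ⟨h.1, h.2, h.3, h.4, h.5, h.6, h.7⟩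

theorem Inv.addTime {P : Input n} {Q : ℕ} {s : State n} {g : Fin n → ℕ → Bool}
    {act : ℕ → Fin n → Bool} {stk : ℕ → List (Fin n × List (Fin n))} {lev : ℕ → Fin n → ℕ}
    (h : Inv P Q s g act stk lev) (t : ℕ) : Inv P Q { s with time := t } g act stk lev :=
  ⟨h.1, h.2, h.3, h.4, h.5.addTime t⟩

/-! ### The potential -/

/-- The potential of one level of a node with `d` neighbours. -/
def levelPot (N d : ℕ) : ℕ := computeCost N d + 8 * d * N + 6 * d

/-- The potential of the pair `(v, i)`. -/
noncomputable def cellPot (P : Input n) (s : State n) (g : Fin n → ℕ → Bool) (v : Fin n) (i : ℕ) : ℕ :=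
  levelPot P.cap (P.adj v).length * (2 * s.k v i + if g v i then 0 else 1) +
    8 * (P.adj v).length * (s.B v i).length

/-- The potential of the state. -/
noncomputable def pot (P : Input n) (s : State n) (g : Fin n → ℕ → Bool) : ℕ :=
  ∑ v, ∑ i ∈ Finset.range (P.h + 1), cellPot P s g v i + ∑ v, s.key v

/-- The potential of a stack. -/
def stackPot (P : Input n) (l : List (Fin n × List (Fin n))) : ℕ :=
  (l.map fun e => 2 + 8 * (P.adj e.1).length * e.2.length).sum

@[simp] theorem stackPot_nil (P : Input n) : stackPot P [] = 0 := rfl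

@[simp] theorem stackPot_cons (P : Input n) (e : Fin n × List (Fin n))
    (l : List (Fin n × List (Fin n))) :
    stackPot P (e :: l) = 2 + 8 * (P.adj e.1).length * e.2.length + stackPot P l := by
  simp [stackPot]

/-! ### Calling `Compute` -/

theorem others_eq (P : Input n) (s : State n) (v : Fin n) :
    others P s v = ((keys (s.B v P.h)).filter (fun x => x ≠ v)).length := by
  rw [others, ← keys_filter (fun x => x ≠ v), length_keys]

theorem keyVal_mono {N k b k' b' : ℕ} (hk : k' ≤ k) (hb' : b' ≤ N) (hb : k' = k → b' ≤ b) :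
    keyVal N k' b' ≤ keyVal N k b := by
  unfold keyVal
  rcases hk.eq_or_lt with rfl | hlt
  · have := hb rfl; omega
  · have : (k' + 1) * (N + 1) ≤ k * (N + 1) := Nat.mul_le_mul_right _ hlt
    have h2 : (k' + 1) * (N + 1) = k' * (N + 1) + (N + 1) := by ring
    omega

/-- `B` contains every candidate of rank at least the old level `k`, hence `k` is feasible for
`Compute`. With `g`, `D` contains those of rank `k - 1`, and `m = 0` puts all neighbours below level
`k`; so `|B| + |D| ≤ cap` makes `k - 1` feasible. If the level does not change, no neighbour has
that level, and the new `m` vanishes. -/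
theorem ComputeSpec.level_le_of_coupleAt {P : Input n} {s : State n} {v : Fin n} {j : ℕ}
    {T D : List (Fin n × ℕ)} {k m : ℕ} {act : Fin n → Bool} {g : Bool}
    (h : ComputeSpec P v (nbrs P s v) (fun w => keys (s.B w j)) (fun w => s.k w j) T k m D)
    (hact : ∀ w, act w = s.alive w)
    (hC : CoupleAt P (fun w => s.k w j) (effCount s [] j) act v (s.k v (j + 1)) (s.m v (j + 1))
      (s.B v (j + 1)) (s.D v (j + 1)) g)
    (hm : s.m v (j + 1) = 0) (hlen : (s.B v (j + 1)).length + (s.D v (j + 1)).length ≤ P.cap) :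
    k ≤ s.k v (j + 1) ∧
      (∀ x ∈ keys T, s.k v (j + 1) ≤ P.r x → x ∈ keys (s.B v (j + 1))) ∧
      (g → s.k v (j + 1) ≠ 0 → k < s.k v (j + 1)) ∧
      (k = s.k v (j + 1) → m = 0) := by
  have hnbr : ∀ w ∈ nbrs P s v, w ∈ P.adj v ∧ act w := fun w hw => by
    simpa [nbrs, hact] using hw
  have hdem : ∀ x, (x = v ∨ ∃ w ∈ nbrs P s v, x ∈ keys (s.B w j)) →
      0 < demand P (effCount s [] j) v x := by
    rintro x (rfl | ⟨w, hw, hx⟩)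
    · simp [demand]
    · have h1 := le_sum_map (P.adj v) (fun w => effCount s [] j w x) (hnbr w hw).1
      have h2 : 0 < (keys (s.B w j)).count x := List.count_pos_iff.2 hx
      simp only [effCount, List.map_nil, List.sum_nil, add_zero] at h1
      simp only [demand, effCount, List.map_nil, List.sum_nil, add_zero]
      omega
  have hB : ∀ x, s.k v (j + 1) ≤ P.r x → (x = v ∨ ∃ w ∈ nbrs P s v, x ∈ keys (s.B w j)) →
      x ∈ keys (s.B v (j + 1)) := fun x hx hc =>
    mem_keys_of_weight_pos ((hdem x hc).trans_le (hC.demand_le x hx))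
  have hcardB : (keys (s.B v (j + 1))).toFinset.card ≤ (s.B v (j + 1)).length := by
    simpa using List.toFinset_card_le (keys (s.B v (j + 1)))
  have hcardD : (keys (s.D v (j + 1))).toFinset.card ≤ (s.D v (j + 1)).length := by
    simpa using List.toFinset_card_le (keys (s.D v (j + 1)))
  refine ⟨?_, fun x hx hr => hB x hr (h.mem x hx), fun hg hk0 => ?_, fun hk => ?_⟩
  · exact h.minimal _ (keys (s.B v (j + 1))).toFinset
      (fun w hw => hC.level_le w (hnbr w hw).1 (hnbr w hw).2)
      (fun x hx hc => List.mem_toFinset.2 (hB x hx hc)) (by omega)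
  · suffices k ≤ s.k v (j + 1) - 1 by omega
    refine h.minimal _ ((keys (s.B v (j + 1))).toFinset ∪ (keys (s.D v (j + 1))).toFinset)
      (fun w hw => ?_) (fun x hx hc => ?_) ((Finset.card_union_le _ _).trans (by omega))
    · have h1 := hC.level_le w (hnbr w hw).1 (hnbr w hw).2
      have h2 := hC.level_ne hm (hnbr w hw).1 (hnbr w hw).2
      omega
    · rw [Finset.mem_union, List.mem_toFinset, List.mem_toFinset]
      by_cases hr : s.k v (j + 1) ≤ P.r x
      · exact Or.inl (hB x hr hc)
      · exact Or.inr (mem_keys_of_weight_pos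
          ((hdem x hc).trans_le (hC.demand_le_reserve hg x (by omega))))
  · rw [h.m_eq, List.length_eq_zero_iff, List.filter_eq_nil_iff]
    intro w hw
    have := hC.level_ne hm (hnbr w hw).1 (hnbr w hw).2
    simpa [hk] using this

/-- Layer `j` is settled: its stack is empty and its active nodes are the remaining ones. The new
level of `v` is not yet known to layer `j + 2`, so the resulting invariant keeps the old levels of
layer `j + 1` in `lev`. The surplus `6 deg v` will pay for announcing a changed level. -/
theorem compute_step {P : Input n} (hP : P.Valid) {Q : ℕ} {s : State n} {g : Fin n → ℕ → Bool}
    {act : ℕ → Fin n → Bool} {stk : ℕ → List (Fin n × List (Fin n))} {v : Fin n} {j : ℕ}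
    (hI : Inv P Q s g act stk (fun j w => s.k w j)) (hj : j < P.h) (hstk : stk j = [])
    (hact : ∀ w, act j w = s.alive w) (hact' : ∀ j w, s.alive w → act j w) (hv : s.alive v)
    (hlen : (s.B v (j + 1)).length + (s.D v (j + 1)).length ≤ P.cap)
    (hm : s.m v (j + 1) = 0) (hg : g v (j + 1) → s.k v (j + 1) ≠ 0) :
    ∃ g' : Fin n → ℕ → Bool, (∀ w l, (w = v → l ≠ j + 1) → g' w l = g w l) ∧
      Inv P Q (compute P v (j + 1) s) g' act stk
        (Function.update (fun l w => (compute P v (j + 1) s).k w l) (j + 1)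
          (fun w => s.k w (j + 1))) ∧
      (compute P v (j + 1) s).k v (j + 1) ≤ s.k v (j + 1) ∧
      (∀ w l, (w = v → l ≠ j + 1) → (compute P v (j + 1) s).k w l = s.k w l) ∧
      (compute P v (j + 1) s).alive = s.alive ∧ (compute P v (j + 1) s).ptr = s.ptr ∧
      (g' v (j + 1) → (compute P v (j + 1) s).k v (j + 1) = 0 → nbrs P s v = []) ∧
      (compute P v (j + 1) s).time + pot P (compute P v (j + 1) s) g' + 6 * (P.adj v).length ≤
        s.time + pot P s g := by
  obtain ⟨T, k, m, D, c, heq, hc, hS⟩ := compute_spec P s j v hP.one_le_cap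
    (fun w => hI.ordered w j) (fun w => hI.length_le w j) (hI.length_le v (j + 1))
  have hCv := hI.couple j hj v hv
  rw [hstk] at hCv
  obtain ⟨hk, hTB, hklt, hm0⟩ := hS.level_le_of_coupleAt hact hCv hm hlen
  rw [heq]
  refine ⟨set2 g v (j + 1) (decide (m = 0)), fun w l h => set2_of_ne _ _ h,
    ⟨?_, ?_, ?_, ?_, ?_⟩, ?_, fun w l h => set2_of_ne _ _ h, rfl, rfl, ?_, ?_⟩
  · intro w l
    simp only
    by_cases h : w = v ∧ l = j + 1
    · obtain ⟨rfl, rfl⟩ := h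
      rw [set2_self]; exact hS.ordered
    · rw [set2_of_ne _ _ (fun h1 h2 => h ⟨h1, h2⟩)]; exact hI.ordered w l
  · intro w l
    simp only
    by_cases h : w = v ∧ l = j + 1
    · obtain ⟨rfl, rfl⟩ := h
      rw [set2_self]; exact hS.length_le
    · rw [set2_of_ne _ _ (fun h1 h2 => h ⟨h1, h2⟩)]; exact hI.length_le w l
  · intro l hl w hw
    simp only
    rw [set2_of_ne]
    · exact hI.eq_nil l hl w hw
    · rintro rfl
      rw [hact' l w hv] at hw
      simp at hw
  · intro l hl w hw
    simp only at hw ⊢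
    have hCw := hI.couple l hl w hw
    by_cases hlj : l = j
    · subst hlj
      have hlev : Function.update (fun i w => set2 s.k v (l + 1) k w i) (l + 1)
          (fun w => s.k w (l + 1)) l = fun w => s.k w l := by
        rw [Function.update_of_ne (by omega)]
        funext w
        exact set2_of_ne _ _ (by omega)
      have heff : ∀ t : State n, t.B = set2 s.B v (l + 1) T →
          effCount t (stk l) l = effCount s [] l := by
        intro t ht
        funext w x
        rw [hstk, effCount, effCount, ht, set2_of_ne _ _ (by omega)]
      rw [hlev, heff _ rfl]
      by_cases hwv : w = v
      · subst hwv
        simp only [set2_self]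
        exact hS.coupleAt hact fun w hw => hI.eq_nil l hl w (by simpa using hw)
      · simp only [set2_of_ne _ _ (fun h => absurd h hwv)]
        rw [hstk] at hCw
        exact hCw
    · have hne : w = v → l + 1 ≠ j + 1 := fun _ => by omega
      simp only [set2_of_ne _ _ hne]
      by_cases hlj' : l = j + 1
      · subst hlj'
        rw [Function.update_self]
        refine hCw.of_effCount_le fun u _ => ?_
        by_cases huv : u = v
        · subst huv
          refine Or.inr ⟨hact' _ _ hv, fun x hx => ?_⟩
          -- The new list may have gained nodes, but only below the old level: at or above it, `T`
          -- is duplicate-free and contained in the old list.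
          simp only [effCount, set2_self]
          refine Nat.add_le_add_right ?_ _
          by_cases hxT : x ∈ keys T
          · have h1 := List.nodup_iff_count_le_one.1 hS.ordered.nodup x
            have h2 := List.count_pos_iff.2 (hTB x hxT hx)
            omega
          · rw [List.count_eq_zero_of_not_mem hxT]; exact Nat.zero_le _
        · refine Or.inl fun x => ?_
          simp only [effCount, set2_of_ne _ _ (fun h => absurd h huv)]
          exact le_rfl
      · rw [Function.update_of_ne hlj']
        have hlev : (fun w => set2 s.k v (j + 1) k w l) = fun w => s.k w l := by
          funext w
          exact set2_of_ne _ _ (fun _ => hlj')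
        rw [hlev]
        refine hCw.of_effCount_le fun u _ => Or.inl fun x => ?_
        simp only [effCount, set2_of_ne _ _ (fun _ => hlj')]
        exact le_rfl
  · have hq := hI.queue
    refine ⟨hq.1, hq.2, hq.3, hq.4, fun w hw => ?_, hq.6, hq.7⟩
    refine le_trans ?_ (hq.keyVal_le w hw)
    rw [others_eq, others_eq]
    simp only
    by_cases h : w = v ∧ P.h = j + 1
    · obtain ⟨rfl, hh⟩ := h
      rw [hh, set2_self, set2_self]
      refine keyVal_mono hk ?_ fun hkk => ?_
      · refine (List.length_filter_le _ _).trans ?_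
        rw [length_keys]; exact hS.length_le
      · rw [← List.toFinset_card_of_nodup (hS.ordered.nodup.filter _)]
        refine le_trans (Finset.card_le_card ?_) (List.toFinset_card_le _)
        intro x hx
        rw [List.mem_toFinset, List.mem_filter] at hx ⊢
        exact ⟨hTB x hx.1 (hkk ▸ hS.level_le_rank x hx.1), hx.2⟩
    · rw [set2_of_ne _ _ (fun h1 h2 => h ⟨h1, h2⟩), set2_of_ne _ _ (fun h1 h2 => h ⟨h1, h2⟩)]
  · simp only [set2_self]; exact hk
  · simp only [set2_self]
    -- At level `0` every remaining neighbour has level `0` and would be counted in `m`; so `m = 0`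
    -- leaves none.
    intro h1 h2
    rw [hS.m_eq, decide_eq_true_eq, List.length_eq_zero_iff, List.filter_eq_nil_iff] at h1
    rw [List.eq_nil_iff_forall_not_mem]
    intro w hw
    refine h1 w hw ?_
    have := hS.nbr_level_le w hw
    simp only [decide_eq_true_eq]
    omega
  · have hpot : pot P { s with
          B := set2 s.B v (j + 1) T
          k := set2 s.k v (j + 1) k
          m := set2 s.m v (j + 1) m
          D := set2 s.D v (j + 1) D
          time := s.time + c } (set2 g v (j + 1) (decide (m = 0))) +
        (computeCost P.cap (P.adj v).length + 6 * (P.adj v).length) ≤ pot P s g := by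
      unfold pot
      rw [add_right_comm]
      refine Nat.add_le_add_right (sum_cell_add_le (i₀ := j + 1) (v₀ := v) (by omega) ?_ ?_) _
      · intro w l h
        simp only [cellPot, set2_of_ne _ _ h]
      · simp only [cellPot, set2_self, decide_eq_true_eq]
        -- The factor `2` lets a drop of the level pay even if the flag is switched off again. At an
        -- unchanged level the flag goes from off to on.
        have hφ : (2 * k + if m = 0 then 0 else 1) + 1 ≤
            2 * s.k v (j + 1) + if g v (j + 1) then 0 else 1 := by
          rcases hk.eq_or_lt with h1 | h1
          · have h2 : ¬ g v (j + 1) := fun h2 => by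
              have := hklt h2 (hg h2); omega
            rw [if_pos (hm0 h1), if_neg h2]; omega
          · split_ifs <;> omega
        have h1 := Nat.mul_le_mul_left (levelPot P.cap (P.adj v).length) hφ
        rw [mul_add, mul_one] at h1
        have h2 : 8 * (P.adj v).length * T.length ≤ 8 * (P.adj v).length * P.cap :=
          Nat.mul_le_mul_left _ hS.length_le
        -- One unit pays for the call, for refilling the list to at most `cap` entries of potential
        -- `8 deg v` each, and for one announcement of the level.
        have h3 : levelPot P.cap (P.adj v).length = computeCost P.cap (P.adj v).length +
          8 * (P.adj v).length * P.cap + 6 * (P.adj v).length := rfl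
        omega
    simp only
    omega

/-! ### Re-evaluating an estimate -/

/-- The buckets after `v` has been moved to the bucket `q`. -/
theorem move_bucket (bucket : ℕ → List (Fin n)) (key : Fin n → ℕ) (v : Fin n) (q : ℕ)
    (hof : ∀ p w, w ∈ bucket p → key w = p) (hnd : ∀ p, (bucket p).Nodup)
    (bk bk' : ℕ → List (Fin n))
    (hbk : bk = Function.update bucket (key v) ((bucket (key v)).erase v))
    (hbk' : bk' = Function.update bk q (v :: bk q)) :
    (∀ p w, w ∈ bk' p ↔ (w = v ∧ p = q) ∨ (w ≠ v ∧ w ∈ bucket p)) ∧ ∀ p, (bk' p).Nodup := by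
  have h1 : ∀ p w, w ∈ bk p ↔ w ≠ v ∧ w ∈ bucket p := by
    intro p w
    by_cases hp : p = key v
    · subst hp
      rw [hbk, Function.update_self, (hnd _).mem_erase_iff]
    · rw [hbk, Function.update_of_ne hp]
      refine ⟨fun h => ⟨?_, h⟩, fun h => h.2⟩
      rintro rfl
      exact hp (hof p w h).symm
  have h2 : ∀ p, (bk p).Nodup := by
    intro p
    by_cases hp : p = key v
    · subst hp
      rw [hbk, Function.update_self]
      exact (hnd _).erase _
    · rw [hbk, Function.update_of_ne hp]; exact hnd p
  refine ⟨fun p w => ?_, fun p => ?_⟩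
  · by_cases hp : p = q
    · subst hp
      rw [hbk', Function.update_self, List.mem_cons, h1]
      simp
    · rw [hbk', Function.update_of_ne hp, h1]
      simp [hp]
  · by_cases hp : p = q
    · subst hp
      rw [hbk', Function.update_self, List.nodup_cons]
      exact ⟨by simp [h1], h2 p⟩
    · rw [hbk', Function.update_of_ne hp]; exact h2 p

/-- The pointer is at most the old key of `v`, so it falls back by no more than the key does. In
`time + pot - ptr` the two cancel and one step remains; the inequality is stated without
subtraction. -/
theorem setEstimate_step {P : Input n} {Q : ℕ} {s : State n} {g : Fin n → ℕ → Bool}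
    {act : ℕ → Fin n → Bool} {stk : ℕ → List (Fin n × List (Fin n))} {lev : ℕ → Fin n → ℕ}
    (hI : Inv P Q s g act stk lev) {v : Fin n} (hv : s.alive v) :
    Inv P Q (setEstimate P v s) g act stk lev ∧
      (setEstimate P v s).time + pot P (setEstimate P v s) g + s.ptr ≤
        s.time + 1 + pot P s g + (setEstimate P v s).ptr := by
  have hq := hI.queue
  set q := keyVal P.cap (s.k v P.h) (others P s v) with hqdef
  have hqle : q ≤ s.key v := hq.keyVal_le v hv
  obtain ⟨hmem, hnd⟩ := move_bucket s.bucket s.key v q (fun p w h => (hq.of_mem_bucket p w h).2)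
    hq.nodup _ _ rfl rfl
  have hkey : ∀ w, (setEstimate P v s).key w = if w = v then q else s.key w := by
    intro w
    simp only [setEstimate, Function.update_apply]; rfl
  have hptr : (setEstimate P v s).ptr = min s.ptr q := rfl
  refine ⟨⟨hI.1, hI.2, hI.3, hI.4, ⟨fun w hw => ?_, fun p w hw => ?_, hnd, fun w hw => ?_,
    fun w hw => ?_, fun w hw => ?_, ?_⟩⟩, ?_⟩
  · refine (hmem _ _).2 ?_
    rw [hkey]
    split_ifs with h
    · exact Or.inl ⟨h, rfl⟩
    · exact Or.inr ⟨h, hq.mem_bucket w hw⟩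
  · rw [hkey]
    rcases (hmem p w).1 hw with ⟨rfl, rfl⟩ | ⟨h1, h2⟩
    · exact ⟨hv, if_pos rfl⟩
    · rw [if_neg h1]; exact hq.of_mem_bucket p w h2
  · rw [hkey, hptr]
    split_ifs with h
    · exact min_le_right _ _
    · exact (min_le_left _ _).trans (hq.ptr_le_key w hw)
  · rw [hkey]
    split_ifs with h
    · rw [h]; exact le_rfl
    · exact hq.keyVal_le w hw
  · rw [hkey]
    split_ifs with h
    · exact hqle.trans (hq.key_le v hv)
    · exact hq.key_le w hw
  · rw [hptr]; exact (min_le_left _ _).trans hq.ptr_le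
  · have h1 : ∑ w, (setEstimate P v s).key w + (s.key v - q) = ∑ w, s.key w := by
      rw [← Finset.add_sum_erase _ _ (Finset.mem_univ v),
        ← Finset.add_sum_erase _ s.key (Finset.mem_univ v), hkey, if_pos rfl,
        Finset.sum_congr rfl fun w hw => (by
          rw [hkey, if_neg (Finset.ne_of_mem_erase hw)] :
          (setEstimate P v s).key w = s.key w)]
      change q + ∑ w ∈ Finset.univ.erase v, s.key w + (s.key v - q) =
        s.key v + ∑ w ∈ Finset.univ.erase v, s.key w
      omega
    have h2 : (setEstimate P v s).time = s.time + 1 := rfl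
    have h3 : pot P (setEstimate P v s) g =
        ∑ v, ∑ i ∈ Finset.range (P.h + 1), cellPot P s g v i +
          ∑ w, (setEstimate P v s).key w := rfl
    have h4 := hq.ptr_le_key v hv
    rw [h2, h3, hptr]
    unfold pot
    omega

/-! ### Processing an entry of the stack -/

/-- The potential `8 deg w` of each unlinked entry moves from its cell to the stack. The `2` prepays
popping the new stack entry and re-evaluating one estimate. -/
theorem pot_propagate {P : Input n} {g : Fin n → ℕ → Bool} {i k : ℕ} {Y : List (Fin n)} {c : Bool}
    (hi : i < P.h) (acc : State n × List (Fin n × List (Fin n))) (w : Fin n) :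
    pot P (propagate i Y k c acc w).1 g + stackPot P (propagate i Y k c acc w).2 ≤
      pot P acc.1 g + stackPot P acc.2 + 2 := by
  obtain ⟨s, nxt⟩ := acc
  have h : ∑ v, ∑ j ∈ Finset.range (P.h + 1), cellPot P (propagate i Y k c (s, nxt) w).1 g v j +
      8 * (P.adj w).length * (delete (s.B w (i + 1)) Y).2.1.length ≤
      ∑ v, ∑ j ∈ Finset.range (P.h + 1), cellPot P s g v j := by
    refine sum_cell_add_le (i₀ := i + 1) (v₀ := w) (by omega) (fun v j hvj => ?_) ?_
    · simp only [cellPot, propagate, set2_of_ne _ _ hvj]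
    · simp only [cellPot, propagate, set2_self]
      have := length_delete (s.B w (i + 1)) Y
      rw [add_assoc, ← mul_add, this]
  have h2 : stackPot P (propagate i Y k c (s, nxt) w).2 =
    2 + 8 * (P.adj w).length * (delete (s.B w (i + 1)) Y).2.1.length + stackPot P nxt := by
    simp [propagate]
  have h3 : ∑ v, (propagate i Y k c (s, nxt) w).1.key v = ∑ v, s.key v := rfl
  unfold pot
  rw [h2, h3]
  simp only
  omega

theorem pot_foldl_propagate {P : Input n} {g : Fin n → ℕ → Bool} {i k : ℕ} {Y : List (Fin n)}
    {c : Bool} (hi : i < P.h) (L : List (Fin n)) (acc : State n × List (Fin n × List (Fin n))) :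
    pot P (L.foldl (propagate i Y k c) acc).1 g +
        stackPot P (L.foldl (propagate i Y k c) acc).2 ≤
      pot P acc.1 g + stackPot P acc.2 + 2 * L.length := by
  induction L generalizing acc with
  | nil => simp
  | cons w L ih =>
    have h1 := ih (propagate i Y k c acc w)
    have h2 := pot_propagate (P := P) (g := g) (k := k) (Y := Y) (c := c) hi acc w
    simp only [List.foldl_cons, List.length_cons]
    omega

theorem sum_map_ite_eq (L : List (Fin n)) (hL : L.Nodup) (w : Fin n) (f : Fin n → ℕ) :
    (L.map fun a => if a = w then f a else 0).sum = if w ∈ L then f w else 0 := by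
  induction L with
  | nil => simp
  | cons a L ih =>
    rw [List.nodup_cons] at hL
    rw [List.map_cons, List.sum_cons, ih hL.2]
    by_cases h : a = w
    · subst h; simp [hL.1]
    · simp [h, Ne.symm h]

theorem CoupleAt.congr {P : Input n} {lev lev' : Fin n → ℕ} {E E' : Fin n → Fin n → ℕ}
    {act act' : Fin n → Bool} {v : Fin n} {k m : ℕ} {B D : List (Fin n × ℕ)} {g : Bool}
    (h : CoupleAt P lev E act v k m B D g)
    (he : ∀ w ∈ P.adj v, lev' w = lev w ∧ act' w = act w ∧ E' w = E w) :
    CoupleAt P lev' E' act' v k m B D g := by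
  have hdem : ∀ x, demand P E' v x = demand P E v x := fun x => by
    unfold demand
    rw [List.map_congr_left fun w hw => by rw [(he w hw).2.2]]
  refine ⟨fun w hw ha => ?_, ?_, fun x hx => ?_, h.m_eq_zero, fun hg x hx => ?_⟩
  · rw [(he w hw).1]; rw [(he w hw).2.1] at ha
    exact h.level_le w hw ha
  · rw [List.map_congr_left fun w hw => by rw [(he w hw).1, (he w hw).2.1]]
    exact h.count_le
  · rw [hdem]; exact h.demand_le x hx
  · rw [hdem]; exact h.demand_le_reserve hg x hx

theorem effCount_cons (s : State n) (v : Fin n) (Y : List (Fin n))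
    (l : List (Fin n × List (Fin n))) (j : ℕ) (w x : Fin n) :
    effCount s ((v, Y) :: l) j w x = effCount s l j w x + if v = w then Y.count x else 0 := by
  simp only [effCount, List.map_cons, List.sum_cons]; omega

/-- Layer `i + 1` loses from its counters exactly the waiting contributions `Y` that leave the
stack, and learns the current level of `v₀`. What it unlinks reappears on the next stack, so the
contributions to layer `i + 2` are unchanged. The function `a'` allows `v₀` to be deactivated, as
happens for the deleted node. -/
theorem inv_foldl_propagate {P : Input n} (hP : P.Valid) {Q : ℕ} {s : State n}
    {g : Fin n → ℕ → Bool} {act : ℕ → Fin n → Bool} {stk : ℕ → List (Fin n × List (Fin n))}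
    {lev : ℕ → Fin n → ℕ} {i : ℕ} {v₀ : Fin n} {Y : List (Fin n)}
    {rest : List (Fin n × List (Fin n))} {c : Bool} {a' : Fin n → Bool}
    (hI : Inv P Q s g act stk lev) (hi : i < P.h) (hstk : stk i = (v₀, Y) :: rest)
    (hlev : ∀ j, j ≠ i → lev j = fun w => s.k w j) (hlevi : ∀ w, w ≠ v₀ → lev i w = s.k w i)
    (hact : act i v₀) (ha' : ∀ w, w ≠ v₀ → a' w = act i w)
    (hc : c = false → s.k v₀ i = lev i v₀ ∧ a' v₀ = true)
    (hc' : c = true → a' v₀ = false ∨ s.k v₀ i < lev i v₀)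
    (hnil : a' v₀ = false → s.B v₀ i = []) :
    Inv P Q ((nbrs P s v₀).foldl (propagate i Y (lev i v₀) c) (s, stk (i + 1))).1 g
      (Function.update act i a')
      (Function.update (Function.update stk i rest) (i + 1)
        ((nbrs P s v₀).foldl (propagate i Y (lev i v₀) c) (s, stk (i + 1))).2)
      (fun j w => ((nbrs P s v₀).foldl (propagate i Y (lev i v₀) c) (s, stk (i + 1))).1.k w j) := by
  have hLnd : (nbrs P s v₀).Nodup := (hP.nodup v₀).filter _
  rw [foldl_propagate i Y (lev i v₀) c _ hLnd]
  have hLmem : ∀ w, w ∈ nbrs P s v₀ ↔ w ∈ P.adj v₀ ∧ s.alive w := fun w => by simp [nbrs]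
  set L := nbrs P s v₀ with hL
  have hact'of : ∀ j w, Function.update act i a' j w = false → s.B w j = [] ∨ act j w = false := by
    intro j w h
    by_cases hj : j = i
    · subst hj
      rw [Function.update_self] at h
      by_cases hw : w = v₀
      · subst hw; exact Or.inl (hnil h)
      · rw [ha' w hw] at h; exact Or.inr h
    · rw [Function.update_of_ne hj] at h; exact Or.inr h
  refine ⟨fun w j => ?_, fun w j => ?_, fun j hj w hw => ?_, fun j hj v hv => ?_, ?_⟩
  · simp only
    split_ifs
    · exact (hI.ordered w j).delete Y
    · exact hI.ordered w j
  · simp only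
    have h1 := hI.length_le w j
    have h2 := length_delete (s.B w j) Y
    split_ifs
    · omega
    · exact h1
  · simp only
    have h1 : s.B w j = [] := (hact'of j w hw).elim id (hI.eq_nil j hj w)
    rw [h1]
    split_ifs
    · have := length_delete ([] : List (Fin n × ℕ)) Y
      simp only [List.length_nil] at this
      exact List.length_eq_zero_iff.1 (by omega)
    · rfl
  · simp only at hv ⊢
    have hCv := hI.couple j hj v hv
    by_cases hji : j = i
    · subst hji
      rw [Function.update_self, Function.update_of_ne (by omega), Function.update_self]
      have hE : ∀ (t : State n), (∀ w, t.B w j = s.B w j) → ∀ w x,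
          effCount t rest j w x + (if v₀ = w then Y.count x else 0) =
            effCount s (stk j) j w x := by
        intro t ht w x
        rw [hstk, effCount_cons]
        simp only [effCount, ht]
      set t : State n := { s with
          B := fun w j' => if j' = j + 1 ∧ w ∈ L then (delete (s.B w j') Y).1 else s.B w j'
          D := fun w j' => if j' = j + 1 ∧ w ∈ L then (delete (s.D w j') Y).1 else s.D w j'
          m := fun w j' => if (j' = j + 1 ∧ w ∈ L) ∧ c ∧ lev j v₀ = s.k w j' then s.m w j' - 1
            else s.m w j'
          time := s.time + L.length * (2 * Y.length + 3) } with ht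
      have hEt := hE t (fun w => by simp [ht])
      by_cases hvL : v ∈ L
      · have hv₀ : v₀ ∈ P.adj v := hP.symm _ _ ((hLmem v).1 hvL).1
        simp only [hvL, and_self, if_true, true_and]
        have hne : ∀ w, w ≠ v₀ → effCount t rest j w = effCount s (stk j) j w := by
          intro w hw
          funext x
          have := hEt w x
          rwa [if_neg (Ne.symm hw), add_zero] at this
        refine hCv.delete (changed := c) hv₀ (fun w hw => (hlevi w hw).symm) ha' hne
          (fun x => ?_) (fun h => ?_) hact hc' (fun h => ?_) ?_ ?_
        · have := hEt v₀ x
          rw [if_pos rfl] at this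
          exact this.le
        · have := hc (by simpa using h)
          exact ⟨this.1, this.2.trans hact.symm⟩
        · rw [if_neg h]
        · split_ifs <;> omega
        · split_ifs <;> omega
      · have hv₀ : v₀ ∉ P.adj v := fun h => hvL ((hLmem v).2 ⟨hP.symm _ _ h, hv⟩)
        simp only [hvL, and_false, false_and, if_false]
        refine hCv.congr fun w hw => ?_
        have hwv : w ≠ v₀ := fun h => hv₀ (h ▸ hw)
        refine ⟨(hlevi w hwv).symm, ha' w hwv, ?_⟩
        funext x
        have := hEt w x
        rwa [if_neg (Ne.symm hwv), add_zero] at this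
    · have hj1 : j + 1 ≠ i + 1 := by omega
      simp only [hj1, false_and, if_false]
      refine hCv.congr fun w _ => ⟨by rw [hlev j hji], by rw [Function.update_of_ne hji], ?_⟩
      funext x
      by_cases hji' : j = i + 1
      · subst hji'
        rw [Function.update_self]
        simp only [effCount, List.map_append, List.sum_append, List.map_reverse, List.sum_reverse,
          List.map_map, Function.comp_def, true_and]
        rw [sum_map_ite_eq L hLnd w]
        -- Each node removed from `B[w, i + 1]` is counted once on the new stack, so `effCount` is
        -- preserved exactly.
        have := count_keys_delete x (s.B w (i + 1)) Y
        split_ifs <;> omega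
      · rw [Function.update_of_ne hji', Function.update_of_ne hji]
        simp only [effCount, hji', false_and, if_false]
  · have hq := hI.queue
    refine ⟨hq.1, hq.2, hq.3, hq.4, fun w hw => ?_, hq.6, hq.7⟩
    refine le_trans ?_ (hq.keyVal_le w hw)
    rw [others_eq, others_eq]
    simp only
    refine Nat.add_le_add_left ?_ _
    split_ifs
    · exact ((keys_delete _ _).2.filter _).length_le
    · exact le_rfl

/-- The entries of the stack of round `i` belong to remaining nodes.  A node without remaining
neighbours occurs at most once, and not if it has reached its final state. -/
structure StackOk (P : Input n) (s : State n) (g : Fin n → ℕ → Bool) (i : ℕ)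
    (l : List (Fin n × List (Fin n))) : Prop where
  alive : ∀ e ∈ l, s.alive e.1
  level_ne_zero : ∀ e ∈ l, g e.1 i → s.k e.1 i ≠ 0
  nodup : ((l.map Prod.fst).filter (fun v => nbrs P s v = [])).Nodup

theorem StackOk.nil (P : Input n) (s : State n) (g : Fin n → ℕ → Bool) (i : ℕ) :
    StackOk P s g i [] := ⟨by simp, by simp, by simp⟩

theorem StackOk.congr {P : Input n} {s s' : State n} {g g' : Fin n → ℕ → Bool} {i : ℕ}
    {l : List (Fin n × List (Fin n))} (h : StackOk P s g i l) (halive : s'.alive = s.alive)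
    (hg : ∀ v, g' v i = g v i) (hk : ∀ v, s'.k v i = s.k v i) : StackOk P s' g' i l := by
  refine ⟨by rw [halive]; exact h.1, fun e he => by rw [hg, hk]; exact h.2 e he, ?_⟩
  have : ∀ v, nbrs P s' v = nbrs P s v := fun v => by rw [nbrs, nbrs, halive]
  simp only [this]
  exact h.3

/-- The invariant sees stacks only through `effCount`, and only in layers below `h`; this permits a
change of bookkeeping. -/
theorem Inv.of_effCount_eq {P : Input n} {Q : ℕ} {s : State n} {g : Fin n → ℕ → Bool}
    {act act' : ℕ → Fin n → Bool} {stk stk' : ℕ → List (Fin n × List (Fin n))}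
    {lev lev' : ℕ → Fin n → ℕ} (h : Inv P Q s g act stk lev)
    (hact : ∀ j < P.h, act' j = act j) (hlev : ∀ j < P.h, lev' j = lev j)
    (hstk : ∀ j < P.h, effCount s (stk' j) j = effCount s (stk j) j) :
    Inv P Q s g act' stk' lev' := by
  refine ⟨h.1, h.2, fun j hj w hw => h.3 j hj w ?_, fun j hj v hv => ?_, h.5⟩
  · rw [← hact j hj]; exact hw
  · rw [hact j hj, hlev j hj, hstk j hj]; exact h.couple j hj v hv

theorem propagate_step {P : Input n} (hP : P.Valid) {Q : ℕ} {s : State n}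
    {g : Fin n → ℕ → Bool} {act : ℕ → Fin n → Bool} {stk : ℕ → List (Fin n × List (Fin n))}
    {lev : ℕ → Fin n → ℕ} {i : ℕ} {v₀ : Fin n} {Y : List (Fin n)}
    {rest : List (Fin n × List (Fin n))} {c : Bool} {a' : Fin n → Bool}
    (hI : Inv P Q s g act stk lev) (hi : i < P.h) (hstk : stk i = (v₀, Y) :: rest)
    (hlev : ∀ j, j ≠ i → lev j = fun w => s.k w j) (hlevi : ∀ w, w ≠ v₀ → lev i w = s.k w i)
    (hact : act i v₀) (ha' : ∀ w, w ≠ v₀ → a' w = act i w)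
    (hc : c = false → s.k v₀ i = lev i v₀ ∧ a' v₀ = true)
    (hc' : c = true → a' v₀ = false ∨ s.k v₀ i < lev i v₀)
    (hnil : a' v₀ = false → s.B v₀ i = []) (hok : StackOk P s g (i + 1) (stk (i + 1)))
    (hnew : s.alive v₀ ∨ stk (i + 1) = [])
    (r : State n × List (Fin n × List (Fin n)))
    (hr : r = (nbrs P s v₀).foldl (propagate i Y (lev i v₀) c) (s, stk (i + 1))) :
    Inv P Q r.1 g (Function.update act i a')
        (Function.update (Function.update stk i rest) (i + 1) r.2) (fun j w => r.1.k w j) ∧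
      StackOk P r.1 g (i + 1) r.2 ∧ r.1.alive = s.alive ∧ r.1.k = s.k ∧ r.1.ptr = s.ptr ∧
      r.1.time + pot P r.1 g + stackPot P r.2 ≤ s.time + pot P s g + stackPot P (stk (i + 1)) +
        (P.adj v₀).length * (2 * Y.length + 5) := by
  have hinv := inv_foldl_propagate hP hI hi hstk hlev hlevi hact ha' hc hc' hnil
  have hpot := pot_foldl_propagate (P := P) (g := g) (k := lev i v₀) (Y := Y) (c := c) hi
    (nbrs P s v₀) (s, stk (i + 1))
  rw [← hr] at hinv hpot
  have hLnd : (nbrs P s v₀).Nodup := (hP.nodup v₀).filter _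
  have hlen : (nbrs P s v₀).length ≤ (P.adj v₀).length := List.length_filter_le _ _
  rw [foldl_propagate i Y (lev i v₀) c _ hLnd] at hr
  have halive : r.1.alive = s.alive := by rw [hr]
  have hk : r.1.k = s.k := by rw [hr]
  have htime : r.1.time = s.time + (nbrs P s v₀).length * (2 * Y.length + 3) := by rw [hr]
  have hr2 := congrArg Prod.snd hr
  simp only at hr2
  have hL : ∀ w ∈ nbrs P s v₀, w ∈ P.adj v₀ ∧ s.alive w := fun w hw => by
    simpa [nbrs] using hw
  refine ⟨hinv, ?_, halive, hk, by rw [hr], ?_⟩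
  · refine StackOk.congr (s := s) (g := g) ?_ halive (fun _ => rfl) (fun v => by rw [hk])
    rw [hr2]
    refine ⟨fun e he => ?_, fun e he => ?_, ?_⟩
    · rw [List.mem_append, List.mem_reverse, List.mem_map] at he
      rcases he with ⟨w, hw, rfl⟩ | he
      · exact (hL w hw).2
      · exact hok.alive e he
    · rw [List.mem_append, List.mem_reverse, List.mem_map] at he
      rcases he with ⟨w, hw, rfl⟩ | he
      -- Before propagation `v₀` is an active neighbour of `w`. With `g` its level is strictly below
      -- that of `w`, which therefore is not `0`.
      · intro hg hk0
        have hC := hI.couple i hi w (hL w hw).2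
        have hv₀ := hP.symm _ _ (hL w hw).1
        have h1 := hC.level_le v₀ hv₀ hact
        have h2 := hC.level_ne (hC.m_eq_zero hg) hv₀ hact
        simp only at hk0
        omega
      · exact hok.level_ne_zero e he
    · rw [List.map_append, List.map_reverse, List.map_map, List.filter_append]
      simp only [Function.comp_def, List.map_id']
      -- If `v₀` remains in the graph, every new entry has a remaining neighbour, so uniqueness is
      -- not affected. If `v₀` is the deleted node, it pushes first, and its neighbours are
      -- distinct.
      rcases hnew with h | h
      · have : (nbrs P s v₀).reverse.filter (fun v => nbrs P s v = []) = [] := by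
          rw [List.filter_eq_nil_iff]
          intro w hw
          rw [List.mem_reverse] at hw
          have : v₀ ∈ nbrs P s w := by
            simp [nbrs, h, hP.symm _ _ (hL w hw).1]
          simp only [decide_eq_true_eq]
          intro h0
          simp [h0] at this
        rw [this, List.nil_append]
        exact hok.nodup
      · rw [h, List.map_nil, List.filter_nil, List.append_nil]
        exact (List.nodup_reverse.2 hLnd).filter _
  · have h1 := Nat.mul_le_mul_right (2 * Y.length + 5) hlen
    have h2 : (nbrs P s v₀).length * (2 * Y.length + 5) =
      (nbrs P s v₀).length * (2 * Y.length + 3) + 2 * (nbrs P s v₀).length := by ring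
    simp only at hpot
    omega

/-- The popped entry and the potential pay for all three stages: Compute, estimate, propagation.
Propagation takes place exactly when layer `j + 2` exists and there is something to tell it. -/
theorem processEntry_step {P : Input n} (hP : P.Valid) {Q : ℕ} {s : State n}
    {g : Fin n → ℕ → Bool} {act : ℕ → Fin n → Bool} {stk : ℕ → List (Fin n × List (Fin n))}
    {u v : Fin n} {Y : List (Fin n)} {rest : List (Fin n × List (Fin n))} {j : ℕ}
    (hI : Inv P Q s g act stk (fun j w => s.k w j)) (hj : j < P.h) (hu : s.alive u = false)
    (hstk : stk (j + 1) = (v, Y) :: rest) (hstk0 : stk j = [])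
    (hact : ∀ w, act j w = s.alive w) (hact' : ∀ j w, s.alive w → act j w)
    (hok : StackOk P s g (j + 1) ((v, Y) :: rest))
    (hok' : StackOk P s g (j + 1 + 1) (stk (j + 1 + 1)))
    (r : State n × List (Fin n × List (Fin n)))
    (hr : r = processEntry P u (j + 1) (s, stk (j + 1 + 1)) (v, Y)) :
    ∃ g', Inv P Q r.1 g' act
        (Function.update (Function.update stk (j + 1) rest) (j + 1 + 1) r.2)
        (fun j w => r.1.k w j) ∧
      StackOk P r.1 g' (j + 1) rest ∧ StackOk P r.1 g' (j + 1 + 1) r.2 ∧ r.1.alive = s.alive ∧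
      r.1.time + pot P r.1 g' + stackPot P rest + stackPot P r.2 + s.ptr ≤
        s.time + pot P s g + stackPot P ((v, Y) :: rest) + stackPot P (stk (j + 1 + 1)) +
          r.1.ptr := by
  have hv : s.alive v := hok.alive (v, Y) (by simp)
  have hvu : v ≠ u := by rintro rfl; simp [hu] at hv
  set s₀ : State n := { s with time := s.time + 1 } with hs₀
  have hI₀ : Inv P Q s₀ g act stk (fun j w => s₀.k w j) := hI.addTime _
  set s₁ := if v ≠ u ∧ (s₀.B v (j + 1)).length + (s₀.D v (j + 1)).length ≤ P.cap ∧
    s₀.m v (j + 1) = 0 then compute P v (j + 1) s₀ else s₀ with hs₁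
  set s₂ := if v ≠ u ∧ j + 1 = P.h then setEstimate P v s₁ else s₁ with hs₂
  have hr' : r = if j + 1 < P.h ∧ (v = u ∨ Y ≠ [] ∨ s₂.k v (j + 1) ≠ s.k v (j + 1)) then
      (nbrs P { s₂ with time := s₂.time + (P.adj v).length } v).foldl
        (propagate (j + 1) Y (s.k v (j + 1)) (decide (v = u ∨ s₂.k v (j + 1) ≠ s.k v (j + 1))))
        ({ s₂ with time := s₂.time + (P.adj v).length }, stk (j + 1 + 1))
      else (s₂, stk (j + 1 + 1)) := hr
  -- A changed level must come from a call of `Compute`, whose surplus `6 deg v` is kept for the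
  -- propagation; hence the conditional term.
  have step₁ : ∃ g₁ : Fin n → ℕ → Bool, (∀ w l, (w = v → l ≠ j + 1) → g₁ w l = g w l) ∧
      Inv P Q s₁ g₁ act stk (Function.update (fun l w => s₁.k w l) (j + 1)
        (fun w => s.k w (j + 1))) ∧
      s₁.k v (j + 1) ≤ s.k v (j + 1) ∧
      (∀ w l, (w = v → l ≠ j + 1) → s₁.k w l = s.k w l) ∧ s₁.alive = s.alive ∧
      s₁.ptr = s.ptr ∧ StackOk P s₁ g₁ (j + 1) rest ∧
      s₁.time + pot P s₁ g₁ + (if s₁.k v (j + 1) = s.k v (j + 1) then 0 else 6 * (P.adj v).length)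
        ≤ s.time + 1 + pot P s g := by
    by_cases hcond : v ≠ u ∧ (s₀.B v (j + 1)).length + (s₀.D v (j + 1)).length ≤ P.cap ∧
      s₀.m v (j + 1) = 0
    · obtain ⟨g₁, h1, h2, h3, h4, h5, h6, h7, h8⟩ := compute_step hP hI₀ hj hstk0 hact hact' hv
        hcond.2.1 hcond.2.2 (hok.level_ne_zero (v, Y) (by simp))
      rw [hs₁, if_pos hcond]
      refine ⟨g₁, h1, h2, h3, h4, h5, h6, ⟨fun e he => ?_, fun e he hg hk0 => ?_, ?_⟩, ?_⟩
      · rw [h5]; exact hok.alive e (by simp [he])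
      -- If `v` has just reached its final state, it has no remaining neighbours, so it has no
      -- second entry on the stack.
      · by_cases hev : e.1 = v
        · rw [hev] at hg hk0
          have hnil : nbrs P s v = [] := h7 hg hk0
          have hnd := hok.nodup
          rw [List.map_cons, List.filter_cons_of_pos (by simpa using hnil), List.nodup_cons] at hnd
          exact hnd.1 (List.mem_filter.2 ⟨List.mem_map.2 ⟨e, he, hev⟩, by simpa using hnil⟩)
        · rw [h1 _ _ (fun h => absurd h hev)] at hg
          rw [h4 _ _ (fun h => absurd h hev)] at hk0
          exact hok.level_ne_zero e (by simp [he]) hg hk0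
      · have : ∀ w, nbrs P (compute P v (j + 1) s₀) w = nbrs P s w := fun w => by
          rw [nbrs, nbrs, h5]
        simp only [this]
        have hnd := hok.nodup
        rw [List.map_cons] at hnd
        exact hnd.sublist ((List.sublist_cons_self _ _).filter _)
      · have : pot P s₀ g = pot P s g := rfl
        have h9 : s₀.time = s.time + 1 := rfl
        split_ifs <;> omega
    · rw [hs₁, if_neg hcond]
      refine ⟨g, fun _ _ _ => rfl, ?_, le_rfl, fun _ _ _ => rfl, rfl, rfl,
        ⟨fun e he => hok.alive e (by simp [he]), fun e he => hok.level_ne_zero e (by simp [he]),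
          ?_⟩, ?_⟩
      · convert hI₀ using 1
        exact Function.update_eq_self (j + 1) (fun l w => s.k w l)
      · have hnd := hok.nodup
        rw [List.map_cons] at hnd
        exact hnd.sublist ((List.sublist_cons_self _ _).filter _)
      · rw [if_pos rfl]; exact le_rfl
  obtain ⟨g₁, hg₁, hI₁, hkle, hkne, halive₁, hptr₁, hok₁, htime₁⟩ := step₁
  have step₂ : Inv P Q s₂ g₁ act stk (Function.update (fun l w => s₂.k w l) (j + 1)
        (fun w => s.k w (j + 1))) ∧ s₂.k = s₁.k ∧ s₂.alive = s₁.alive ∧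
      s₂.time + pot P s₂ g₁ + s₁.ptr ≤ s₁.time + 1 + pot P s₁ g₁ + s₂.ptr := by
    by_cases hcond : v ≠ u ∧ j + 1 = P.h
    · rw [hs₂, if_pos hcond]
      obtain ⟨h1, h2⟩ := setEstimate_step hI₁ (v := v) (by rw [halive₁]; exact hv)
      exact ⟨h1, rfl, rfl, h2⟩
    · rw [hs₂, if_neg hcond]
      exact ⟨hI₁, rfl, rfl, by omega⟩
  obtain ⟨hI₂, hk₂, halive₂, htime₂⟩ := step₂
  rw [← hk₂] at hkle hkne htime₁
  have halive₂' : s₂.alive = s.alive := halive₂.trans halive₁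
  have hok₂ : StackOk P s₂ g₁ (j + 1) rest :=
    hok₁.congr halive₂ (fun _ => rfl) (fun _ => by rw [hk₂])
  have hok₂' : StackOk P s₂ g₁ (j + 1 + 1) (stk (j + 1 + 1)) :=
    hok'.congr halive₂' (fun _ => hg₁ _ _ (by omega)) (fun _ => hkne _ _ (by omega))
  rw [stackPot_cons]
  refine ⟨g₁, ?_⟩
  by_cases hcond : j + 1 < P.h ∧ (v = u ∨ Y ≠ [] ∨ s₂.k v (j + 1) ≠ s.k v (j + 1))
  · rw [if_pos hcond] at hr'
    have hI₃ := hI₂.addTime (s₂.time + (P.adj v).length)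
    set s₃ : State n := { s₂ with time := s₂.time + (P.adj v).length } with hs₃
    obtain ⟨h1, h2, h3, h4, h5, h6⟩ := propagate_step hP
      (lev := Function.update (fun l w => s₂.k w l) (j + 1) (fun w => s.k w (j + 1)))
      (a' := act (j + 1)) (c := decide (v = u ∨ s₂.k v (j + 1) ≠ s.k v (j + 1)))
      hI₃ hcond.1 hstk
      (fun l hl => by rw [Function.update_of_ne hl])
      (fun w hw => by rw [Function.update_self]; exact (hkne w _ (fun h => absurd h hw)).symm)
      (hact' _ _ hv) (fun _ _ => rfl)
      (fun hc => by
        rw [Function.update_self]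
        rw [decide_eq_false_iff_not, not_or, not_not] at hc
        exact ⟨hc.2, hact' _ _ hv⟩)
      (fun hc => by
        rw [Function.update_self]
        rw [decide_eq_true_eq] at hc
        rcases hc with hc | hc
        · exact absurd hc hvu
        · exact Or.inr (lt_of_le_of_ne hkle hc))
      (fun h => by rw [hact' _ _ hv] at h; simp at h)
      (hok₂'.congr rfl (fun _ => rfl) (fun _ => rfl))
      (Or.inl (by rw [hs₃]; exact (congrFun halive₂' v).trans hv)) r
      (by rw [Function.update_self]; exact hr')
    rw [Function.update_eq_self] at h1
    refine ⟨h1, hok₂.congr h3 (fun _ => rfl) (fun _ => by rw [h4]), h2, h3.trans halive₂', ?_⟩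
    have h7 : s₃.time = s₂.time + (P.adj v).length := rfl
    have h8 : s₃.ptr = s₂.ptr := rfl
    have h9 : pot P s₃ g₁ = pot P s₂ g₁ := rfl
    -- For `Y ≠ []` the linear overhead `6 deg v` is absorbed by `8 deg v |Y|`. For `Y = []` the
    -- level has changed, and the surplus of `Compute` pays it.
    have h10 : (P.adj v).length * (2 * Y.length + 5) + (P.adj v).length ≤
        8 * (P.adj v).length * Y.length +
        (if s₂.k v (j + 1) = s.k v (j + 1) then 0 else 6 * (P.adj v).length) := by
      split_ifs with hk
      · have hY : Y ≠ [] := by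
          rcases hcond.2 with h | h | h
          · exact absurd h hvu
          · exact h
          · exact absurd hk h
        have := Nat.mul_le_mul_left (P.adj v).length (List.length_pos_iff.2 hY)
        nlinarith
      · nlinarith [Nat.zero_le ((P.adj v).length * Y.length)]
    simp only
    omega
  · rw [if_neg hcond] at hr'
    rw [hr']
    refine ⟨hI₂.of_effCount_eq (fun _ _ => rfl) (fun l hl => ?_) (fun l hl => ?_), hok₂, hok₂',
      halive₂', ?_⟩
    -- If layer `j + 2` exists, skipping the propagation means that the level is unchanged and `Y =
    -- []`, so layer `j + 2` is already up to date.
    · by_cases hlj : l = j + 1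
      · subst hlj
        rw [Function.update_self]
        funext w
        by_cases hw : w = v
        · subst hw
          by_contra h
          exact hcond ⟨hl, Or.inr (Or.inr h)⟩
        · exact hkne w _ (fun h => absurd h hw)
      · rw [Function.update_of_ne hlj]
    · by_cases hlj : l = j + 1 + 1
      · subst hlj; rw [Function.update_self]
      · rw [Function.update_of_ne hlj]
        by_cases hlj' : l = j + 1
        · subst hlj'
          rw [Function.update_self, hstk]
          funext w x
          have hY : Y = [] := by
            by_contra h
            exact hcond ⟨hl, Or.inr (Or.inl h)⟩
          rw [effCount_cons, hY]
          simp
        · rw [Function.update_of_ne hlj']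
    · simp only
      split_ifs at htime₁ <;> omega

/-! ### The rounds of an update -/

/-- The stacks during round `i`. -/
def roundStk (i : ℕ) (l nxt : List (Fin n × List (Fin n))) (j : ℕ) : List (Fin n × List (Fin n)) :=
  if j = i then l else if j = i + 1 then nxt else []

theorem update_roundStk (i : ℕ) (l l' nxt nxt' : List (Fin n × List (Fin n))) :
    Function.update (Function.update (roundStk i l nxt) i l') (i + 1) nxt' = roundStk i l' nxt' := by
  funext j
  simp only [Function.update_apply, roundStk]
  grind

/-- The active nodes when the rounds before `i` of `Update(u)` are finished. -/
def active (s : State n) (u : Fin n) (i j : ℕ) (w : Fin n) : Bool :=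
  s.alive w || decide (w = u ∧ i ≤ j)

theorem foldl_processEntry {P : Input n} (hP : P.Valid) {Q : ℕ} {u : Fin n} {j : ℕ}
    (hj : j < P.h) {act : ℕ → Fin n → Bool} (l : List (Fin n × List (Fin n))) {s : State n}
    {g : Fin n → ℕ → Bool} {nxt : List (Fin n × List (Fin n))}
    (hI : Inv P Q s g act (roundStk (j + 1) l nxt) (fun j w => s.k w j)) (hu : s.alive u = false)
    (hact : ∀ w, act j w = s.alive w) (hact' : ∀ j w, s.alive w → act j w)
    (hok : StackOk P s g (j + 1) l) (hok' : StackOk P s g (j + 1 + 1) nxt)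
    (r : State n × List (Fin n × List (Fin n)))
    (hr : r = l.foldl (processEntry P u (j + 1)) (s, nxt)) :
    ∃ g', Inv P Q r.1 g' act (roundStk (j + 1) [] r.2) (fun j w => r.1.k w j) ∧
      StackOk P r.1 g' (j + 1 + 1) r.2 ∧ r.1.alive = s.alive ∧
      r.1.time + pot P r.1 g' + stackPot P r.2 + s.ptr ≤
        s.time + pot P s g + stackPot P l + stackPot P nxt + r.1.ptr := by
  induction l generalizing s g nxt with
  | nil =>
    subst hr
    exact ⟨g, hI, hok', rfl, by simp⟩
  | cons e l ih =>
    obtain ⟨v, Y⟩ := e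
    rw [List.foldl_cons] at hr
    have hnxt : roundStk (j + 1) ((v, Y) :: l) nxt (j + 1 + 1) = nxt := by simp [roundStk]
    obtain ⟨g₁, h1, h2, h3, h4, h5⟩ := processEntry_step hP hI hj hu (by simp [roundStk])
      (by rw [roundStk, if_neg (by omega), if_neg (by omega)]) hact hact' hok
      (by rw [hnxt]; exact hok') _ rfl
    rw [hnxt] at h1 h2 h3 h4 h5
    rw [update_roundStk] at h1
    obtain ⟨g₂, h6, h7, h8, h9⟩ := ih h1 (by rw [h4]; exact hu) (fun w => by rw [h4]; exact hact w)
      (fun j w hw => hact' j w (by rw [← h4]; exact hw)) h2 h3 hr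
    exact ⟨g₂, h6, h7, h8.trans h4, by omega⟩

/-- At the start of round `i` the list `B[u, i]` is moved to the stack. -/
theorem inv_clear {P : Input n} {Q : ℕ} {s : State n} {g : Fin n → ℕ → Bool}
    {act : ℕ → Fin n → Bool} {l : List (Fin n × List (Fin n))} {u : Fin n} {i : ℕ}
    (hI : Inv P Q s g act (roundStk i l []) (fun j w => s.k w j)) (hu : s.alive u = false)
    (s' : State n) (t : ℕ) (hs' : s' = { s with B := set2 s.B u i [], time := t }) :
    Inv P Q s' g act (roundStk i ((u, keys (s.B u i)) :: l) []) (fun j w => s'.k w j) := by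
  have hB : ∀ w j, s'.B w j = [] ∨ s'.B w j = s.B w j := by
    intro w j
    rw [hs']
    by_cases h : w = u ∧ j = i
    · obtain ⟨rfl, rfl⟩ := h
      exact Or.inl (set2_self _ _ _ _)
    · exact Or.inr (set2_of_ne _ _ (fun h1 h2 => h ⟨h1, h2⟩))
  have hB' : ∀ w j, w ≠ u → s'.B w j = s.B w j := by
    intro w j h
    rw [hs']
    exact set2_of_ne _ _ (fun h1 => absurd h1 h)
  have hne : ∀ w, s.alive w → w ≠ u := by
    rintro w hw rfl; simp [hu] at hw
  -- The occurrences in `B[u, i]` move to the entry of `u`, and `effCount` adds up both places.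
  have hE : ∀ j, effCount s' (roundStk i ((u, keys (s.B u i)) :: l) [] j) j =
      effCount s (roundStk i l [] j) j := by
    intro j
    funext w x
    by_cases hj : j = i
    · subst hj
      simp only [roundStk, if_true]
      rw [effCount_cons]
      by_cases hw : u = w
      · subst hw
        have h0 : s'.B u j = [] := by rw [hs']; exact set2_self _ _ _ _
        rw [if_pos rfl, effCount, effCount, h0, keys_nil, List.count_nil]
        omega
      · rw [if_neg hw, effCount, effCount, hB' w j (Ne.symm hw), add_zero]
    · have h0 : s'.B w j = s.B w j := by
        rw [hs']; exact set2_of_ne _ _ (fun _ => hj)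
      simp only [roundStk, if_neg hj, effCount, h0]
  refine ⟨fun w j => ?_, fun w j => ?_, fun j hj w hw => ?_, fun j hj v hv => ?_, ?_⟩
  · rcases hB w j with h | h
    · rw [h]; simp [Ordered]
    · rw [h]; exact hI.ordered w j
  · rcases hB w j with h | h
    · rw [h]; simp
    · rw [h]; exact hI.length_le w j
  · rcases hB w j with h | h
    · exact h
    · rw [h]; exact hI.eq_nil j hj w hw
  · have hv' : s.alive v := by rw [hs'] at hv; exact hv
    have := hI.couple j hj v hv'
    rw [hE, hB' v _ (hne v hv'), hs']
    exact this
  · have hq := hI.queue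
    have h5 := hq.5
    subst hs'
    refine ⟨hq.1, hq.2, hq.3, hq.4, fun w hw => ?_, hq.6, hq.7⟩
    have := h5 w hw
    rw [others] at this ⊢
    rw [hB' w _ (hne w hw)]
    exact this

/-- The work of one round that is not paid by the potential. -/
noncomputable def roundCost (P : Input n) (u : Fin n) : ℕ := P.cap + 2 + 6 * (P.adj u).length

/-- The deleted node is processed first: it is never recomputed, it empties its list, and it becomes
inactive in layer `i`. The old entries then find the layer below settled by the preceding round. -/
theorem round_step {P : Input n} (hP : P.Valid) {Q : ℕ} {s : State n} {g : Fin n → ℕ → Bool}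
    {l : List (Fin n × List (Fin n))} {u : Fin n} {i : ℕ} (hi : i ≤ P.h)
    (hI : Inv P Q s g (active s u i) (roundStk i l []) (fun j w => s.k w j))
    (hu : s.alive u = false) (hl : i = 0 → l = []) (hok : StackOk P s g i l)
    (r : State n × List (Fin n × List (Fin n))) (hr : r = round P u (s, l) i) :
    ∃ g', Inv P Q r.1 g' (active r.1 u (i + 1)) (roundStk (i + 1) r.2 []) (fun j w => r.1.k w j) ∧
      StackOk P r.1 g' (i + 1) r.2 ∧ r.1.alive = s.alive ∧
      r.1.time + pot P r.1 g' + stackPot P r.2 + s.ptr ≤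
        s.time + pot P s g + stackPot P l + r.1.ptr + roundCost P u := by
  set Y := keys (s.B u i) with hY
  have hYlen : Y.length ≤ P.cap := by rw [hY, length_keys]; exact hI.length_le u i
  set s₁ : State n := { s with B := set2 s.B u i [], time := s.time + 1 + Y.length } with hs₁
  have hI₁ := inv_clear hI hu s₁ _ hs₁
  have hpot₁ : pot P s₁ g + 8 * (P.adj u).length * Y.length ≤ pot P s g := by
    unfold pot
    rw [add_right_comm]
    refine Nat.add_le_add_right (sum_cell_add_le (i₀ := i) (v₀ := u) (by omega) ?_ ?_) _
    · intro w j h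
      simp only [cellPot, hs₁, set2_of_ne _ _ h]
    · simp only [cellPot, hs₁, set2_self, hY, length_keys, List.length_nil]
      omega
  rw [show round P u (s, l) i = l.foldl (processEntry P u i) (processEntry P u i (s₁, []) (u, Y))
    from rfl] at hr
  have step : ∃ r₁ : State n × List (Fin n × List (Fin n)),
      r₁ = processEntry P u i (s₁, []) (u, Y) ∧
      Inv P Q r₁.1 g (active s u (i + 1)) (roundStk i l r₁.2) (fun j w => r₁.1.k w j) ∧
      StackOk P r₁.1 g i l ∧ StackOk P r₁.1 g (i + 1) r₁.2 ∧ r₁.1.alive = s.alive ∧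
      r₁.1.time + pot P r₁.1 g + stackPot P r₁.2 + s.ptr ≤ s.time + pot P s g + r₁.1.ptr +
        roundCost P u := by
    refine ⟨_, rfl, ?_⟩
    by_cases hih : i < P.h
    · set s₃ : State n := { s₁ with time := s₁.time + 1 + (P.adj u).length } with hs₃
      have hI₃ : Inv P Q s₃ g _ _ (fun j w => s₃.k w j) :=
        hI₁.addTime (s₁.time + 1 + (P.adj u).length)
      have heq : processEntry P u i (s₁, []) (u, Y) =
          (nbrs P s₃ u).foldl (propagate i Y (s₃.k u i) true) (s₃, []) := by
        simp only [processEntry, ne_eq, not_true_eq_false, false_and, if_false, hih, true_or,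
          and_self, if_true, decide_true]
        rfl
      rw [heq]
      have hst : roundStk i ((u, Y) :: l) [] (i + 1) = ([] : List (Fin n × List (Fin n))) := by
        simp [roundStk]
      obtain ⟨h1, h2, h3, h4, h5, h6⟩ := propagate_step hP hI₃ hih (rest := l) (v₀ := u) (Y := Y)
        (c := true) (a' := s.alive) (by simp [roundStk, hY]) (fun _ _ => rfl) (fun _ _ => rfl)
        (by simp [active]) (fun w hw => by simp [active, hw]) (by simp) (fun _ => Or.inl hu)
        (fun _ => by simp [hs₃, hs₁, set2_self]) (by rw [← hY, hst]; exact StackOk.nil _ _ _ _)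
        (Or.inr (by rw [← hY]; exact hst)) _ rfl
      rw [← hY, hst] at h1 h2 h3 h4 h5 h6
      rw [update_roundStk] at h1
      refine ⟨h1.of_effCount_eq (fun j hj => ?_) (fun _ _ => rfl) (fun _ _ => rfl),
        hok.congr h3 (fun _ => rfl) (fun _ => by rw [h4]), h2, h3, ?_⟩
      · funext w
        by_cases hji : j = i
        · subst hji; simp [active]
        · rw [Function.update_of_ne hji]
          simp only [active]
          congr 2
          rw [eq_iff_iff]
          exact and_congr_right fun _ => by omega
      · have h7 : s₃.time = s.time + 1 + Y.length + 1 + (P.adj u).length := rfl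
        have h8 : pot P s₃ g = pot P s₁ g := rfl
        have h9 : s₃.ptr = s.ptr := rfl
        rw [h5, h9]
        rw [stackPot_nil] at h6
        -- The product term `2 deg u |Y|` is covered by the potential of the cleared list; the rest
        -- is `roundCost`.
        unfold roundCost
        nlinarith
    · have heq : processEntry P u i (s₁, []) (u, Y) = ({ s₁ with time := s₁.time + 1 }, []) := by
        simp only [processEntry, ne_eq, not_true_eq_false, false_and, if_false, hih]
      rw [heq]
      refine ⟨(hI₁.addTime (s₁.time + 1)).of_effCount_eq (fun j hj => ?_) (fun _ _ => rfl)
        (fun j hj => ?_), hok.congr rfl (fun _ => rfl) (fun _ => rfl), StackOk.nil _ _ _ _, rfl, ?_⟩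
      · funext w
        simp only [active]
        congr 2
        rw [eq_iff_iff]
        exact and_congr_right fun _ => by omega
      · have : j ≠ i := by omega
        simp [roundStk, this]
      · change s.time + 1 + Y.length + 1 + pot P s₁ g + 0 + s.ptr ≤
          s.time + pot P s g + s.ptr + roundCost P u
        unfold roundCost
        omega
  obtain ⟨r₁, hr₁, hI₂, hok₂, hok₂', halive₂, htime₂⟩ := step
  have hact : active r₁.1 u (i + 1) = active s u (i + 1) := by
    unfold active; rw [halive₂]
  have hst : ∀ nxt, roundStk (i + 1) nxt [] = roundStk (n := n) i [] nxt := by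
    intro nxt; funext j; simp only [roundStk]; grind
  rw [← hr₁] at hr
  -- Round `0` has no layer below to compute from, but its stack contains only the entry of `u`.
  rcases i with _ | j
  · rw [hl rfl] at hr hI₂ ⊢
    simp only [List.foldl_nil] at hr
    subst hr
    refine ⟨g, ?_, hok₂', halive₂, by rw [stackPot_nil]; omega⟩
    rw [hact, hst]
    exact hI₂
  · obtain ⟨g₃, h1, h2, h3, h4⟩ := foldl_processEntry hP (by omega) l hI₂ (by rw [halive₂]; exact hu)
      (fun w => by simp [active, halive₂]) (fun j w hw => by rw [halive₂] at hw; simp [active, hw])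
      hok₂ hok₂' r hr
    refine ⟨g₃, ?_, h2, h3.trans halive₂, by omega⟩
    have : active r.1 u (j + 1 + 1) = active s u (j + 1 + 1) := by
      unfold active; rw [h3, halive₂]
    rw [this, hst]
    exact h1

/-- All rounds of `Update(u)`. -/
theorem rounds_step {P : Input n} (hP : P.Valid) {Q : ℕ} {s : State n} {g : Fin n → ℕ → Bool}
    {u : Fin n}
    (hI : Inv P Q s g (active s u 0) (fun _ => []) (fun j w => s.k w j))
    (hu : s.alive u = false) (i : ℕ) (hi : i ≤ P.h + 1)
    (r : State n × List (Fin n × List (Fin n)))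
    (hr : r = (List.range i).foldl (round P u) (s, [])) :
    ∃ g', Inv P Q r.1 g' (active r.1 u i) (roundStk i r.2 []) (fun j w => r.1.k w j) ∧
      StackOk P r.1 g' i r.2 ∧ r.1.alive = s.alive ∧ (i = 0 → r.2 = []) ∧
      r.1.time + pot P r.1 g' + stackPot P r.2 + s.ptr ≤
        s.time + pot P s g + r.1.ptr + i * roundCost P u := by
  induction i generalizing r with
  | zero =>
    simp only [List.range_zero, List.foldl_nil] at hr
    subst hr
    refine ⟨g, ?_, StackOk.nil _ _ _ _, rfl, fun _ => rfl, by simp⟩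
    convert hI using 1
    funext j
    simp [roundStk]
  | succ i ih =>
    rw [List.range_succ, List.foldl_append, List.foldl_cons, List.foldl_nil] at hr
    obtain ⟨g₁, h1, h2, h3, h4, h5⟩ := ih (by omega) _ rfl
    obtain ⟨g₂, h6, h7, h8, h9⟩ := round_step hP (by omega) h1 (by rw [h3]; exact hu) h4 h2 r hr
    refine ⟨g₂, h6, h7, h8.trans h3, by simp, ?_⟩
    rw [add_mul, one_mul]
    omega

/-- The invariant between two iterations of the main loop. -/
def MainInv (P : Input n) (Q : ℕ) (s : State n) (g : Fin n → ℕ → Bool) : Prop :=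
  Inv P Q s g (fun _ => s.alive) (fun _ => []) (fun j w => s.k w j)

theorem update_step {P : Input n} (hP : P.Valid) {Q : ℕ} {s : State n} {g : Fin n → ℕ → Bool}
    {u : Fin n} (hI : Inv P Q { s with alive := Function.update s.alive u false } g
      (active { s with alive := Function.update s.alive u false } u 0)
      (fun _ => []) (fun j w => s.k w j)) :
    ∃ g', MainInv P Q (update P u s) g' ∧
      (update P u s).alive = Function.update s.alive u false ∧
      (update P u s).time + pot P (update P u s) g' + s.ptr ≤
        s.time + 1 + pot P s g + (update P u s).ptr + (P.h + 1) * roundCost P u := by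
  obtain ⟨g', h1, h2, h3, h4, h5⟩ := rounds_step hP (hI.addTime (s.time + 1))
    (by simp) (P.h + 1) le_rfl _ rfl
  refine ⟨g', ?_, h3, ?_⟩
  · refine h1.of_effCount_eq (fun j hj => ?_) (fun _ _ => rfl) (fun j hj => ?_)
    · funext w
      have : ¬ P.h + 1 ≤ j := by omega
      simp only [active, this, and_false, decide_false, Bool.or_false]
      rfl
    · have h6 : j ≠ P.h + 1 := by omega
      simp only [roundStk, h6, if_false]
      split_ifs <;> rfl
  · have h7 : pot P { s with
      alive := Function.update s.alive u false, time := s.time + 1 } g = pot P s g := rfl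
    simp only at h5
    rw [h7] at h5
    exact (Nat.add_le_add_right (Nat.le_add_right _ _) _).trans h5

/-! ### The main loop -/

theorem advance_spec (bucket : ℕ → List (Fin n)) (fuel p : ℕ) :
    (advance bucket fuel p).2 ≤ (advance bucket fuel p).1 + 1 - p ∧
      p ≤ (advance bucket fuel p).1 ∧
      ∀ q, p ≤ q → q < (advance bucket fuel p).1 → bucket q = [] := by
  induction fuel generalizing p with
  | zero => exact ⟨by simp [advance], le_rfl, fun q h1 h2 => by simp [advance] at h2; omega⟩
  | succ fuel ih =>
    obtain ⟨h1, h2, h3⟩ := ih (p + 1)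
    by_cases hp : bucket p = []
    · simp only [advance, hp, if_true]
      refine ⟨by omega, by omega, fun q hq hq' => ?_⟩
      rcases hq.eq_or_lt with rfl | hlt
      · exact hp
      · exact h3 q hlt hq'
    · simp only [advance, hp, if_false]
      exact ⟨by omega, le_rfl, fun q h1 h2 => by omega⟩

/-- The search for a bucket is paid by the advance of the pointer, up to one step; together with the
two constant charges this gives the `3`. -/
theorem coreStep_step {P : Input n} (hP : P.Valid) {Q : ℕ} {s : State n} {g : Fin n → ℕ → Bool}
    (hI : MainInv P Q s g) :
    ∃ g', MainInv P Q (coreStep P s) g' ∧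
      ((coreStep P s).time + pot P (coreStep P s) g' + s.ptr ≤
          s.time + pot P s g + (coreStep P s).ptr ∧ (coreStep P s).alive = s.alive ∨
        ∃ u, s.alive u ∧ (coreStep P s).alive = Function.update s.alive u false ∧
          (coreStep P s).time + pot P (coreStep P s) g' + s.ptr ≤
            s.time + pot P s g + (coreStep P s).ptr + (3 + (P.h + 1) * roundCost P u)) := by
  set a := advance s.bucket (Finset.univ.sup s.key + 1) s.ptr with ha
  obtain ⟨ha1, ha2, ha3⟩ := advance_spec s.bucket (Finset.univ.sup s.key + 1) s.ptr
  rw [← ha] at ha1 ha2 ha3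
  rcases hb : s.bucket a.1 with _ | ⟨u, rest⟩
  -- An unsuccessful search leaves the state as it is, so the bound does not need the search to
  -- succeed.
  · have heq : coreStep P s = s := by
      simp only [coreStep]
      rw [← ha, hb]
    rw [heq]
    exact ⟨g, hI, Or.inl ⟨le_rfl, rfl⟩⟩
  · set s' : State n := { s with
        bucket := Function.update s.bucket a.1 rest
        ptr := a.1
        c := max s.c (s.d u)
        core := Function.update s.core u (max s.c (s.d u))
        time := s.time + 1 + a.2 } with hs'
    have heq : coreStep P s = update P u s' := by
      simp only [coreStep]
      rw [← ha, hb]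
    have hq := hI.queue
    have hu := hq.of_mem_bucket a.1 u (by rw [hb]; simp)
    have hnd := hq.nodup a.1
    rw [hb, List.nodup_cons] at hnd
    set s'' : State n := { s' with alive := Function.update s'.alive u false } with hs''
    have halive : ∀ w, s''.alive w → w ≠ u ∧ s.alive w := by
      intro w hw
      simp only [hs'', hs', Function.update_apply] at hw
      split_ifs at hw with h
      exact ⟨h, hw⟩
    have hI' : Inv P Q s'' g (active s'' u 0) (fun _ => []) (fun j w => s'.k w j) := by
      -- Before round `0` the deleted node still counts as active in every layer, so the old
      -- invariant carries over.
      have hact : ∀ j, active s'' u 0 j = s.alive := by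
        intro j
        funext w
        by_cases hw : w = u
        · subst hw; simp [active, hu.1]
        · simp [active, hw, hs'', hs']
      have hQ : QueueInv P s'' Q := by
        refine ⟨fun w hw => ?_, fun q w hw => ?_, fun q => ?_, fun w hw => ?_, fun w hw => ?_,
          fun w hw => hq.key_le w (halive w hw).2, ?_⟩
        · obtain ⟨hwu, hw⟩ := halive w hw
          have h1 := hq.mem_bucket w hw
          simp only [hs'', hs']
          by_cases hk : s.key w = a.1
          · rw [hk, Function.update_self]
            rw [hk, hb, List.mem_cons] at h1
            exact h1.resolve_left hwu
          · rw [Function.update_of_ne hk]; exact h1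
        · simp only [hs'', hs'] at hw ⊢
          have h1 : w ≠ u ∧ w ∈ s.bucket q := by
            by_cases hk : q = a.1
            · subst hk
              rw [Function.update_self] at hw
              exact ⟨fun h => hnd.1 (h ▸ hw), by rw [hb]; simp [hw]⟩
            · rw [Function.update_of_ne hk] at hw
              refine ⟨?_, hw⟩
              rintro rfl
              exact hk ((hq.of_mem_bucket q w hw).2.symm.trans hu.2)
          rw [Function.update_of_ne h1.1]
          exact hq.of_mem_bucket q w h1.2
        · simp only [hs'', hs']
          by_cases hk : q = a.1
          · subst hk; rw [Function.update_self]; exact hnd.2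
          · rw [Function.update_of_ne hk]; exact hq.nodup q
        · obtain ⟨hwu, hw⟩ := halive w hw
          -- A key below the new pointer would belong to a bucket that was found empty.
          by_contra hlt
          have h1 := ha3 (s.key w) (hq.ptr_le_key w hw) (by simpa [hs'', hs'] using hlt)
          have h2 := hq.mem_bucket w hw
          rw [h1] at h2
          simp at h2
        · exact hq.keyVal_le w (halive w hw).2
        · exact (hu.2.symm.le.trans (hq.key_le u hu.1))
      refine ⟨hI.1, hI.2, fun j hj w hw => hI.3 j hj w ?_, fun j hj v hv => ?_, hQ⟩
      · rw [hact] at hw; exact hw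
      · rw [hact]
        exact hI.4 j hj v (halive v hv).2
    obtain ⟨g', h1, h2, h3⟩ := update_step hP hI'
    rw [heq]
    refine ⟨g', h1, Or.inr ⟨u, hu.1, h2, ?_⟩⟩
    have h4 : pot P s' g = pot P s g := rfl
    have h5 : s'.time = s.time + 1 + a.2 := rfl
    have h6 : s'.ptr = a.1 := rfl
    omega

/-- The sum over the remaining nodes is a reserve from which each deletion takes its own share once.
-/
theorem iterate_coreStep {P : Input n} (hP : P.Valid) {Q : ℕ} {s : State n}
    {g : Fin n → ℕ → Bool} (hI : MainInv P Q s g) (t : ℕ) :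
    ∃ g', MainInv P Q ((coreStep P)^[t] s) g' ∧
      ((coreStep P)^[t] s).time + pot P ((coreStep P)^[t] s) g' + s.ptr +
          ∑ u with ((coreStep P)^[t] s).alive u, (3 + (P.h + 1) * roundCost P u) ≤
        s.time + pot P s g + ((coreStep P)^[t] s).ptr +
          ∑ u with s.alive u, (3 + (P.h + 1) * roundCost P u) := by
  induction t with
  | zero => exact ⟨g, hI, le_rfl⟩
  | succ t ih =>
    obtain ⟨g₁, h1, h2⟩ := ih
    rw [Function.iterate_succ_apply']
    obtain ⟨g₂, h3, h4⟩ := coreStep_step hP h1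
    refine ⟨g₂, h3, ?_⟩
    rcases h4 with ⟨h4, h5⟩ | ⟨u, hu, h5, h6⟩
    · rw [h5]; omega
    · rw [h5]
      set s' := (coreStep P)^[t] s
      have h7 : (Finset.univ.filter fun w => Function.update s'.alive u false w = true) =
          (Finset.univ.filter fun w => s'.alive w = true).erase u := by
        ext w
        by_cases hw : w = u
        · subst hw; simp
        · simp [hw]
      have h8 := Finset.add_sum_erase (Finset.univ.filter fun w => s'.alive w = true)
        (fun u => 3 + (P.h + 1) * roundCost P u) (a := u) (by simpa using hu)
      rw [h7]
      omega

/-! ### The initial state -/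

/-- The invariant of the initial calls of `Compute`: all levels are at most `κ`, and the data of the
pairs `(w, l + 1)` with `S l w` have been computed. -/
structure InitInv (P : Input n) (κ : ℕ) (s : State n) (S : ℕ → Fin n → Prop) : Prop where
  alive : ∀ v, s.alive v
  key : ∀ v, s.key v = 0
  bucket : ∀ q, s.bucket q = []
  ptr : s.ptr = 0
  ordered : ∀ v i, Ordered P.r (s.B v i)
  length_le : ∀ v i, (s.B v i).length ≤ P.cap
  level_le : ∀ v i, s.k v i ≤ κ
  couple : ∀ l w, S l w → CoupleAt P (fun w => s.k w l) (effCount s [] l) (fun _ => true) w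
    (s.k w (l + 1)) (s.m w (l + 1)) (s.B w (l + 1)) (s.D w (l + 1)) (decide (s.m w (l + 1) = 0))

theorem InitInv.mono {P : Input n} {κ : ℕ} {s : State n} {S S' : ℕ → Fin n → Prop}
    (h : InitInv P κ s S) (hS : ∀ l w, S' l w → S l w) : InitInv P κ s S' :=
  ⟨h.1, h.2, h.3, h.4, h.5, h.6, h.7, fun l w hw => h.8 l w (hS l w hw)⟩

/-- All nodes of rank at least `κ` fit into one list, so minimality keeps the new level at most `κ`.
Only the data of layer `j + 1` are written, and the pairs computed so far compare with layers at
most `j`. -/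
theorem InitInv.compute {P : Input n} (hP : P.Valid) {κ : ℕ}
    (hκ : (Finset.univ.filter fun x => κ ≤ P.r x).card ≤ P.cap) {s : State n}
    {S : ℕ → Fin n → Prop} (h : InitInv P κ s S) {j : ℕ} (hS : ∀ l w, S l w → l ≤ j) (v : Fin n) :
    InitInv P κ (compute P v (j + 1) s) (fun l w => S l w ∨ (l = j ∧ w = v)) ∧
      (compute P v (j + 1) s).time ≤ s.time + computeCost P.cap (P.adj v).length := by
  obtain ⟨T, k, m, D, c, heq, hc, hC⟩ := compute_spec P s j v hP.one_le_cap
    (fun w => h.ordered w j) (fun w => h.length_le w j) (h.length_le v (j + 1))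
  rw [heq]
  refine ⟨⟨h.1, h.2, h.3, h.4, fun w l => ?_, fun w l => ?_, fun w l => ?_, fun l w hw => ?_⟩,
    Nat.add_le_add_left hc _⟩
  · simp only
    by_cases hwl : w = v ∧ l = j + 1
    · obtain ⟨rfl, rfl⟩ := hwl
      rw [set2_self]; exact hC.ordered
    · rw [set2_of_ne _ _ (fun h1 h2 => hwl ⟨h1, h2⟩)]; exact h.ordered w l
  · simp only
    by_cases hwl : w = v ∧ l = j + 1
    · obtain ⟨rfl, rfl⟩ := hwl
      rw [set2_self]; exact hC.length_le
    · rw [set2_of_ne _ _ (fun h1 h2 => hwl ⟨h1, h2⟩)]; exact h.length_le w l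
  · simp only
    by_cases hwl : w = v ∧ l = j + 1
    · obtain ⟨rfl, rfl⟩ := hwl
      rw [set2_self]
      exact hC.minimal κ _ (fun w _ => h.level_le w j) (fun x hx _ => by simpa using hx) hκ
    · rw [set2_of_ne _ _ (fun h1 h2 => hwl ⟨h1, h2⟩)]; exact h.level_le w l
  · have hlj : l ≤ j := by
      rcases hw with hw | ⟨rfl, -⟩
      · exact hS l w hw
      · exact le_rfl
    have hk : (fun w => set2 s.k v (j + 1) k w l) = fun w => s.k w l := by
      funext w; exact set2_of_ne _ _ (fun _ => by omega)
    have hE : ∀ t : State n, t.B = set2 s.B v (j + 1) T → effCount t [] l = effCount s [] l := by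
      intro t ht
      funext w x
      rw [effCount, effCount, ht, set2_of_ne _ _ (fun _ => by omega)]
    simp only
    rw [hk, hE _ rfl]
    by_cases hwl : w = v ∧ l = j
    · obtain ⟨rfl, rfl⟩ := hwl
      simp only [set2_self]
      exact hC.coupleAt (fun w => (h.alive w).symm) (fun _ hw => absurd rfl hw)
    · have hne : w = v → l + 1 ≠ j + 1 := fun h1 h2 => hwl ⟨h1, by omega⟩
      simp only [set2_of_ne _ _ hne]
      exact h.couple l w (hw.resolve_right fun h1 => hwl ⟨h1.2, h1.1⟩)

theorem InitInv.foldl_compute {P : Input n} (hP : P.Valid) {κ : ℕ}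
    (hκ : (Finset.univ.filter fun x => κ ≤ P.r x).card ≤ P.cap) {j : ℕ} (L : List (Fin n))
    {s : State n} {S : ℕ → Fin n → Prop} (h : InitInv P κ s S) (hS : ∀ l w, S l w → l ≤ j) :
    InitInv P κ (L.foldl (fun s v => DistCore.compute P v (j + 1) s) s)
        (fun l w => S l w ∨ (l = j ∧ w ∈ L)) ∧
      (L.foldl (fun s v => DistCore.compute P v (j + 1) s) s).time ≤
        s.time + (L.map fun v => computeCost P.cap (P.adj v).length).sum := by
  induction L generalizing s S with
  | nil => exact ⟨h.mono (by simp), by simp⟩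
  | cons v L ih =>
    obtain ⟨h1, h2⟩ := h.compute hP hκ hS v
    obtain ⟨h3, h4⟩ := ih h1 (by rintro l w (hw | ⟨rfl, -⟩); exacts [hS l w hw, le_rfl])
    simp only [List.foldl_cons, List.map_cons, List.sum_cons]
    refine ⟨h3.mono fun l w hw => ?_, by omega⟩
    rw [List.mem_cons] at hw
    tauto

theorem initInv_start (P : Input n) (hcap : 1 ≤ P.cap) (κ : ℕ) :
    InitInv P κ (start P) (fun _ _ => False) := by
  refine ⟨fun _ => rfl, fun _ => rfl, fun _ => rfl, rfl, fun v i => ?_, fun v i => ?_,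
    fun _ _ => Nat.zero_le _, by simp⟩
  · simp only [start]; split_ifs <;> simp [Ordered]
  · simp only [start]; split_ifs <;> simp [hcap]

theorem initInv_loop {P : Input n} (hP : P.Valid) {κ : ℕ}
    (hκ : (Finset.univ.filter fun x => κ ≤ P.r x).card ≤ P.cap) (i : ℕ) (s : State n)
    (hs : s = (List.range i).foldl
      (fun s i => (List.finRange n).foldl (fun s v => compute P v (i + 1) s) s) (start P)) :
    InitInv P κ s (fun l _ => l < i) ∧
      s.time ≤ (start P).time + i * ∑ v, computeCost P.cap (P.adj v).length := by
  induction i generalizing s with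
  | zero =>
    subst hs
    exact ⟨(initInv_start P hP.one_le_cap κ).mono (by simp), by simp⟩
  | succ i ih =>
    rw [List.range_succ, List.foldl_append, List.foldl_cons, List.foldl_nil] at hs
    obtain ⟨h1, h2⟩ := ih _ rfl
    obtain ⟨h3, h4⟩ := h1.foldl_compute hP hκ (List.finRange n) (j := i) (fun l _ hl => hl.le)
    rw [← hs] at h3 h4
    refine ⟨h3.mono fun l w hl => ?_, ?_⟩
    · simp only [List.mem_finRange, and_true]; omega
    · have : ((List.finRange n).map fun v => computeCost P.cap (P.adj v).length).sum =
          ∑ v, computeCost P.cap (P.adj v).length := by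
        rw [← List.ofFn_eq_map, List.sum_ofFn]
      rw [add_mul, one_mul]
      omega

/-- The queue while the estimates of the nodes in `A` have been evaluated. -/
theorem foldl_setEstimate (P : Input n) (s₀ : State n) (hkey : ∀ v, s₀.key v = 0)
    (hbucket : ∀ q, s₀.bucket q = []) (hptr : s₀.ptr = 0) (A : List (Fin n)) (hA : A.Nodup)
    (s : State n) (hs : s = A.foldl (fun s v => setEstimate P v s) s₀) :
    s.alive = s₀.alive ∧ s.B = s₀.B ∧ s.k = s₀.k ∧ s.m = s₀.m ∧ s.D = s₀.D ∧ s.ptr = 0 ∧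
      s.time = s₀.time + A.length ∧
      (∀ v, s.key v = if v ∈ A then keyVal P.cap (s₀.k v P.h) (others P s₀ v) else 0) ∧
      (∀ q v, v ∈ s.bucket q ↔ v ∈ A ∧ s.key v = q) ∧ ∀ q, (s.bucket q).Nodup := by
  induction A using List.reverseRecOn generalizing s with
  | nil =>
    subst hs
    simp [hkey, hbucket, hptr]
  | append_singleton A v ih =>
    rw [List.foldl_append, List.foldl_cons, List.foldl_nil] at hs
    rw [List.nodup_append] at hA
    have hvA : v ∉ A := fun h => hA.2.2 v h v (by simp) rfl
    obtain ⟨h1, h2, h3, h4, h5, h6, h7, h8, h9, h10⟩ := ih hA.1 _ rfl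
    set t := A.foldl (fun s v => setEstimate P v s) s₀ with ht
    obtain ⟨hmem, hnd⟩ := move_bucket t.bucket t.key v
      (keyVal P.cap (t.k v P.h) (others P t v)) (fun p w hw => ((h9 p w).1 hw).2) h10 _ _ rfl rfl
    have hothers : others P t v = others P s₀ v := by rw [others, others, h2]
    have hkey' : ∀ w, s.key w = if w = v then keyVal P.cap (s₀.k v P.h) (others P s₀ v)
        else t.key w := by
      intro w
      rw [hs, ← hothers, ← h3]
      simp only [setEstimate, Function.update_apply]
    refine ⟨by rw [hs]; exact h1, by rw [hs]; exact h2, by rw [hs]; exact h3, by rw [hs]; exact h4,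
      by rw [hs]; exact h5, ?_, ?_, fun w => ?_, fun q w => ?_, fun q => ?_⟩
    · rw [hs]
      change min t.ptr _ = 0
      rw [h6, Nat.zero_min]
    · rw [hs]
      change t.time + 1 = _
      rw [h7, List.length_append, List.length_singleton, add_assoc]
    · rw [hkey']
      by_cases hw : w = v
      · subst hw; simp
      · simp [hw, h8]
    · have := hmem q w
      rw [h9] at this
      rw [hkey', hs]
      refine this.trans ?_
      rw [hothers, h3]
      by_cases hw : w = v
      · subst hw; simp [eq_comm]
      · simp [hw]
    · rw [hs]; exact hnd q

theorem others_le {P : Input n} {s : State n} {v : Fin n} (h : (s.B v P.h).length ≤ P.cap) :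
    others P s v ≤ P.cap := (List.length_filter_le _ _).trans h

/-- The flag starts as the test `m = 0`. The bound `κ` on the levels controls both the initial
potential and the largest key, which also bounds the final pointer. -/
theorem mainInv_initial {P : Input n} (hP : P.Valid) {κ : ℕ}
    (hκ : (Finset.univ.filter fun x => κ ≤ P.r x).card ≤ P.cap) :
    ∃ g, MainInv P (keyVal P.cap κ P.cap) (initial P) g ∧ (initial P).ptr = 0 ∧
      (∀ v, (initial P).alive v) ∧
      (initial P).time ≤ 1 + ∑ v, (1 + (P.adj v).length) +
        P.h * ∑ v, computeCost P.cap (P.adj v).length + n ∧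
      pot P (initial P) g ≤ ∑ v, ((P.h + 1) * (levelPot P.cap (P.adj v).length * (2 * κ + 1) +
        8 * (P.adj v).length * P.cap) + keyVal P.cap κ P.cap) := by
  obtain ⟨h1, h2⟩ := initInv_loop hP hκ P.h _ rfl
  set s₀ := (List.range P.h).foldl
    (fun s i => (List.finRange n).foldl (fun s v => compute P v (i + 1) s) s) (start P) with hs₀
  obtain ⟨h3, h4, h5, h6, h7, h8, h9, h10, h11, h12⟩ := foldl_setEstimate P s₀ h1.key h1.bucket
    h1.ptr (List.finRange n) (List.nodup_finRange n) (initial P) rfl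
  simp only [List.mem_finRange, if_true, true_and] at h10 h11
  have halive : ∀ v, (initial P).alive v := fun v => by rw [h3]; exact h1.alive v
  have hkeyle : ∀ v, (initial P).key v ≤ keyVal P.cap κ P.cap := fun v => by
    rw [h10]
    exact keyVal_mono (h1.level_le v P.h) (others_le (h1.length_le v P.h))
      (fun _ => others_le (h1.length_le v P.h))
  refine ⟨fun v l => decide (s₀.m v l = 0), ⟨?_, ?_, ?_, ?_, ?_⟩, h8, halive, ?_, ?_⟩
  · rw [h4]; exact h1.ordered
  · rw [h4]; exact h1.length_le
  · intro j _ w hw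
    rw [halive] at hw
    simp at hw
  · intro j hj v _
    have hact : (initial P).alive = fun _ => true := by funext v; exact halive v
    have hE : effCount (initial P) [] j = effCount s₀ [] j := by
      funext w x; rw [effCount, effCount, h4]
    rw [hact, hE, h4, h5, h6, h7]
    exact h1.couple j v hj
  · refine ⟨fun v _ => (h11 _ _).2 rfl, fun q v hv => ⟨halive v, (h11 q v).1 hv⟩, h12,
      fun v _ => by rw [h8]; exact Nat.zero_le _, fun v _ => ?_, fun v _ => hkeyle v,
      by rw [h8]; exact Nat.zero_le _⟩
    rw [h10, others, others, h4, h5]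
  · have h13 : (start P).time = 1 + ∑ v, (1 + (P.adj v).length) := rfl
    rw [h9, List.length_finRange]
    omega
  · rw [Finset.sum_add_distrib]
    refine Nat.add_le_add (Finset.sum_le_sum fun v _ => ?_) (Finset.sum_le_sum fun v _ => hkeyle v)
    refine (Finset.sum_le_card_nsmul _ _ _ fun i _ => ?_).trans_eq
      (by rw [Finset.card_range, smul_eq_mul])
    rw [cellPot, h4, h5]
    refine Nat.add_le_add (Nat.mul_le_mul_left _ ?_) (Nat.mul_le_mul_left _ (h1.length_le v i))
    have := h1.level_le v i
    split_ifs <;> omega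

theorem keyVal_le_two_mul {N : ℕ} (hN : 1 ≤ N) (κ : ℕ) : keyVal N κ N ≤ 2 * N * (κ + 1) := by
  unfold keyVal
  nlinarith

/-- The contributions to the number of steps, added up. -/
theorem total_le {n N h D κ t t₀ p p' q ptr : ℕ} (hn : 1 ≤ n) (hd : n ≤ D) (hh : 1 ≤ h) (hN : 1 ≤ N)
    (h4 : t₀ ≤ 1 + (n + D) + h * (n * (5 + 2 * N) + D * (6 + 11 * N)) + n)
    (h5 : p ≤ (h + 1) * ((n * (5 + 2 * N) + D * (6 + 11 * N) + 8 * D * N + 6 * D) * (2 * κ + 1) +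
        8 * D * N) + n * keyVal N κ N)
    (h7 : t + p' + 0 + q ≤ t₀ + p + ptr + (3 * n + (h + 1) * (n * (N + 2) + 6 * D)))
    (h8 : ptr ≤ keyVal N κ N) : t ≤ 300 * (h * N * D * (κ + 1)) := by
  have f0 : n ≤ N * D := hd.trans (Nat.le_mul_of_pos_left _ hN)
  have f1 : D ≤ N * D := Nat.le_mul_of_pos_left _ hN
  have f2 : n * N ≤ N * D := (Nat.mul_comm n N).trans_le (Nat.mul_le_mul_left _ hd)
  have f3 : n * (5 + 2 * N) + D * (6 + 11 * N) ≤ 24 * (N * D) := by nlinarith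
  have hx : N * D ≤ h * (N * D) := Nat.le_mul_of_pos_left _ hh
  have hX : h * (N * D) ≤ h * (N * D) * (κ + 1) := Nat.le_mul_of_pos_right _ (by omega)
  -- Each contribution is compared with `X`, using `n ≤ D` and that `h`, `N`, `n` are at least `1`.
  set X := h * (N * D) * (κ + 1) with hXdef
  have f4 : h * (n * (5 + 2 * N) + D * (6 + 11 * N)) ≤ 24 * X := by
    have := Nat.mul_le_mul_left h f3
    nlinarith
  have f5 : keyVal N κ N ≤ 2 * N * (κ + 1) := keyVal_le_two_mul hN κ
  have f6 : n * keyVal N κ N ≤ 2 * X := by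
    calc n * keyVal N κ N ≤ n * (2 * N * (κ + 1)) := Nat.mul_le_mul_left _ f5
      _ = 2 * (n * N * (κ + 1)) := by ring
      _ ≤ 2 * X := Nat.mul_le_mul_left _ (Nat.mul_le_mul_right _ (f2.trans hx))
  have f7 : keyVal N κ N ≤ 2 * X :=
    (Nat.le_mul_of_pos_left _ hn).trans f6
  have f8 : (h + 1) * ((n * (5 + 2 * N) + D * (6 + 11 * N) + 8 * D * N + 6 * D) * (2 * κ + 1) +
        8 * D * N) ≤ 168 * X := by
    have g1 : n * (5 + 2 * N) + D * (6 + 11 * N) + 8 * D * N + 6 * D ≤ 38 * (N * D) := by nlinarith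
    have g2 : (n * (5 + 2 * N) + D * (6 + 11 * N) + 8 * D * N + 6 * D) * (2 * κ + 1) ≤
        38 * (N * D) * (2 * (κ + 1)) := Nat.mul_le_mul g1 (by omega)
    have g3 : 8 * D * N ≤ 8 * (N * D) * (κ + 1) := by
      calc 8 * D * N = 8 * (N * D) := by ring
        _ ≤ _ := Nat.le_mul_of_pos_right _ (by omega)
    calc _ ≤ (2 * h) * (38 * (N * D) * (2 * (κ + 1)) + 8 * (N * D) * (κ + 1)) :=
          Nat.mul_le_mul (by omega) (Nat.add_le_add g2 g3)
      _ = 168 * X := by rw [hXdef]; ring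
  have f9 : 3 * n + (h + 1) * (n * (N + 2) + 6 * D) ≤ 21 * X := by
    have g1 : n * (N + 2) + 6 * D ≤ 9 * (N * D) := by nlinarith
    have g2 : (h + 1) * (n * (N + 2) + 6 * D) ≤ (2 * h) * (9 * (N * D)) :=
      Nat.mul_le_mul (by omega) g1
    have g3 : (2 * h) * (9 * (N * D)) = 18 * (h * (N * D)) := by ring
    omega
  have f10 : h * N * D * (κ + 1) = X := by rw [hXdef]; ring
  rw [f10]
  omega

/-- If at most `⌊M⌋` nodes have rank `κ` or more, then the algorithm makes `O(h m M (κ + 1))`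
steps. -/
theorem time_core_le {P : Input n} (hP : P.Valid) {κ : ℕ}
    (hκ : (Finset.univ.filter fun x => κ ≤ P.r x).card ≤ P.cap) (hn : 1 ≤ n)
    (hd : n ≤ ∑ v, (P.adj v).length) (hh : 1 ≤ P.h) :
    (core P).time ≤ 300 * (P.h * P.cap * (∑ v, (P.adj v).length) * (κ + 1)) := by
  obtain ⟨g, h1, h2, h3, h4, h5⟩ := mainInv_initial hP hκ
  obtain ⟨g', h6, h7⟩ := iterate_coreStep hP h1 n
  have h8 := h6.queue.ptr_le
  rw [h2] at h7
  change (core P).time + _ + 0 + _ ≤ _ at h7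
  have h9 : ∑ u with (initial P).alive u, (3 + (P.h + 1) * roundCost P u) =
      ∑ u, (3 + (P.h + 1) * roundCost P u) := by
    rw [Finset.filter_true_of_mem fun v _ => h3 v]
  have hN := hP.one_le_cap
  set N := P.cap
  set h := P.h
  set D := ∑ v, (P.adj v).length with hD
  have e1 : ∑ v, (1 + (P.adj v).length) = n + D := by simp [Finset.sum_add_distrib, hD]
  have e2 : ∑ v, computeCost N (P.adj v).length = n * (5 + 2 * N) + D * (6 + 11 * N) := by
    simp only [computeCost, Finset.sum_add_distrib, ← Finset.sum_mul, Finset.sum_const,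
      Finset.card_univ, Fintype.card_fin, smul_eq_mul, hD]
    ring
  have e3 : ∑ v, ((h + 1) * (levelPot N (P.adj v).length * (2 * κ + 1) +
        8 * (P.adj v).length * N) + keyVal N κ N) =
      (h + 1) * ((n * (5 + 2 * N) + D * (6 + 11 * N) + 8 * D * N + 6 * D) * (2 * κ + 1) +
        8 * D * N) + n * keyVal N κ N := by
    rw [Finset.sum_add_distrib, ← Finset.mul_sum, Finset.sum_add_distrib, ← Finset.sum_mul]
    simp only [levelPot, Finset.sum_add_distrib, e2, ← Finset.sum_mul, ← Finset.mul_sum,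
      Finset.sum_const, Finset.card_univ, Fintype.card_fin, smul_eq_mul, hD]
  have e4 : ∑ u, (3 + (h + 1) * roundCost P u) =
      3 * n + (h + 1) * (n * (N + 2) + 6 * D) := by
    rw [Finset.sum_add_distrib, ← Finset.mul_sum]
    simp only [roundCost, Finset.sum_add_distrib, ← Finset.mul_sum,
      Finset.sum_const, Finset.card_univ, Fintype.card_fin, smul_eq_mul, hD]
    ring
  rw [e1, e2] at h4
  rw [e3] at h5
  rw [h9, e4] at h7
  exact total_le hn hd hh hN h4 h5 h7 h8

/-! ### The number of nodes of large rank -/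

instance (n : ℕ) : IsProbabilityMeasure (rankMeasure n) := by
  unfold rankMeasure; infer_instance

/-- The parameter of the law of a rank. -/
noncomputable def rankParam : unitInterval := ⟨1 / 2, by norm_num, by norm_num⟩

theorem geometricMeasure_tail (κ : ℕ) :
    (geometricMeasure rankParam).real {k | κ ≤ k} = (1 / 2) ^ κ := by
  have hp : rankParam ≠ 0 := by
    intro h
    have := congrArg Subtype.val h
    norm_num [rankParam] at this
  have hc : {k | κ ≤ k} = ((Finset.range κ : Finset ℕ) : Set ℕ)ᶜ := by
    ext k; simp
  rw [hc, probReal_compl_eq_one_sub (Finset.measurableSet _), ← sum_measureReal_singleton]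
  simp only [geometricMeasure_real_singleton hp]
  have hv : (rankParam : ℝ) = 1 / 2 := rfl
  rw [hv, ← Finset.sum_mul, geom_sum_eq (by norm_num)]
  norm_num
  ring

/-- Chernoff's bound for the number of nodes of rank at least `κ`. -/
theorem rankMeasure_card_gt_le (n N κ : ℕ) :
    2 ^ (N + 1) * (rankMeasure n).real
        {r | N < (Finset.univ.filter fun x => κ ≤ r x).card} ≤ Real.exp (n * (1 / 2) ^ κ) := by
  -- The product of `f (r x)` is `2` to the number of nodes counted; independence turns its
  -- expectation into `(1 + 2⁻ᵏ)ⁿ` at `k = κ`.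
  set f : ℕ → ℝ := fun k => if κ ≤ k then 2 else 1 with hf
  have hf1 : ∀ k, 1 ≤ f k := fun k => by simp only [hf]; split_ifs <;> norm_num
  have hprod : ∀ r : Fin n → ℕ, ∏ x, f (r x) =
      2 ^ (Finset.univ.filter fun x => κ ≤ r x).card := by
    intro r
    simp only [hf]
    rw [Finset.prod_ite]
    simp
  have hint : ∫ r, ∏ x, f (r x) ∂(rankMeasure n) = (1 + (1 / 2) ^ κ) ^ n := by
    rw [rankMeasure, integral_fintype_prod_eq_prod (𝕜 := ℝ) (fun (_ : Fin n) => f)]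
    have h1 : ∫ k, f k ∂(geometricMeasure rankParam) = 1 + (1 / 2) ^ κ := by
      have h2 : f = fun k => 1 + Set.indicator {k | κ ≤ k} (fun _ => (1 : ℝ)) k := by
        funext k
        simp only [hf, Set.indicator_apply, Set.mem_ofPred_eq]
        split_ifs <;> norm_num
      rw [h2, integral_add (integrable_const _)
        ((integrable_const _).indicator (MeasurableSet.of_discrete)),
        integral_indicator_const _ (MeasurableSet.of_discrete), geometricMeasure_tail]
      simp
    change ∏ _x : Fin n, ∫ k, f k ∂(geometricMeasure rankParam) = _
    rw [h1]
    simp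
  have hintegrable : Integrable (fun r => ∏ x, f (r x)) (rankMeasure n) := by
    refine Integrable.of_bound (measurable_of_countable _).aestronglyMeasurable (2 ^ n)
      (Filter.Eventually.of_forall fun r => ?_)
    rw [hprod, Real.norm_of_nonneg (by positivity)]
    refine pow_le_pow_right₀ (by norm_num) ?_
    simpa using Finset.card_le_univ (Finset.univ.filter fun x => κ ≤ r x)
  have hmarkov := mul_meas_ge_le_integral_of_nonneg (μ := rankMeasure n)
    (f := fun r => ∏ x, f (r x))
    (Filter.Eventually.of_forall fun r => Finset.prod_nonneg fun x _ => zero_le_one.trans (hf1 _))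
    hintegrable (2 ^ (N + 1))
  have hset : {r : Fin n → ℕ | N < (Finset.univ.filter fun x => κ ≤ r x).card} =
      {r | (2 : ℝ) ^ (N + 1) ≤ ∏ x, f (r x)} := by
    ext r
    simp only [Set.mem_ofPred_eq]
    rw [hprod, pow_le_pow_iff_right₀ (by norm_num)]
    exact Nat.lt_iff_add_one_le
  rw [hset]
  refine hmarkov.trans ?_
  rw [hint, Real.exp_nat_mul]
  refine pow_le_pow_left₀ (by positivity) ?_ n
  rw [add_comm]
  exact Real.add_one_le_exp _

/-! ### The bounds -/

theorem le_buffer {ε C : ℝ} (hε : 0 < ε) (hC : 0 < C) :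
    8 * (C / ε ^ 2) ≤ buffer ε C ∧ 1 ≤ buffer ε C := by
  have hl : 0 ≤ Real.log 8 := Real.log_nonneg (by norm_num)
  have h1 : 0 < 1 / ε ^ 2 := by positivity
  have h2 : buffer ε C = 1 + 4 * (2 + ε) * (C + Real.log 8) * (1 / ε ^ 2) := by
    unfold buffer; ring
  have h3 : 8 * C ≤ 4 * (2 + ε) * (C + Real.log 8) := by nlinarith [mul_pos hε hC]
  have h4 := mul_le_mul_of_nonneg_right h3 h1.le
  have h5 : 8 * (C / ε ^ 2) = 8 * C * (1 / ε ^ 2) := by ring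
  have h6 : 0 ≤ 8 * C * (1 / ε ^ 2) := by positivity
  constructor <;> linarith

theorem le_div_sq {ε C : ℝ} (hε : 0 < ε) (hε' : ε ≤ 1 / 2) (hC : 0 < C) : 4 * C ≤ C / ε ^ 2 := by
  rw [le_div_iff₀ (by positivity)]
  nlinarith [mul_pos hε hC]

/-- Here `4 (2 + ε) ≤ 10` and `log 8 = 3 log 2 ≤ 3 C` give `40`. The summand `1` is absorbed by `C /
ε² ≥ 4 C ≥ 4 log 2`. -/
theorem buffer_le {ε C : ℝ} (hε : 0 < ε) (hε' : ε ≤ 1 / 2) (hC : Real.log 2 ≤ C) :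
    buffer ε C ≤ 41 * (C / ε ^ 2) := by
  have hl2 := Real.log_two_gt_d9
  have hC0 : 0 < C := by linarith
  have hl : Real.log 8 = 3 * Real.log 2 := by
    rw [show (8 : ℝ) = 2 ^ 3 by norm_num, Real.log_pow]; norm_num
  have h1 : 0 < 1 / ε ^ 2 := by positivity
  have h2 : buffer ε C = 1 + 4 * (2 + ε) * (C + Real.log 8) * (1 / ε ^ 2) := by
    unfold buffer; ring
  have h3 : 4 * (2 + ε) * (C + Real.log 8) ≤ 40 * C := by
    rw [hl]
    nlinarith [mul_pos hε hC0]
  have h4 := mul_le_mul_of_nonneg_right h3 h1.le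
  have h5 : 41 * (C / ε ^ 2) = C / ε ^ 2 + 40 * C * (1 / ε ^ 2) := by ring
  have h6 := le_div_sq hε hε' hC0
  linarith

/-- The bounds `h m M log (n / M)` and `h m R log (n / R)` differ by a constant factor if
`R ≤ M ≤ 41 R`. -/
theorem bounds_equiv {n m h : ℕ} {ε C : ℝ} (hn : 1 ≤ n) (hε : 0 < ε) (hε' : ε ≤ 1 / 2)
    (hC : Real.log 2 ≤ C) :
    boundM n m h ε C ≤ 41 * boundC n m h ε C ∧ boundC n m h ε C ≤ 5 * boundM n m h ε C := by
  have hl2 := Real.log_two_gt_d9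
  have hC0 : 0 < C := by linarith
  have hn0 : (0 : ℝ) < n := by exact_mod_cast hn
  set M := buffer ε C with hM
  set R := C / ε ^ 2 with hR
  have hR0 : 0 < R := by positivity
  have hMR : M ≤ 41 * R := buffer_le hε hε' hC
  have hRM : R ≤ M := by linarith [(le_buffer hε hC0).1]
  have hM0 : 0 < M := hR0.trans_le hRM
  have hbC : boundC n m h ε C = h * m * R * max 1 (Real.log (n / R)) := by
    unfold boundC
    rw [hR]
    congr 1
    · ring
    · congr 2
      field_simp
  have hbM : boundM n m h ε C = h * m * M * max 1 (Real.log (n / M)) := rfl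
  have hlog1 : Real.log (n / M) ≤ Real.log (n / R) := by
    apply Real.log_le_log (by positivity)
    gcongr
  have hlog2 : Real.log (n / R) ≤ Real.log (n / M) + 4 := by
    have h41 : Real.log 41 ≤ 4 := by
      rw [Real.log_le_iff_le_exp (by norm_num)]
      have h1 := Real.exp_one_gt_d9
      have h2 : Real.exp 4 = Real.exp 1 ^ 4 := by rw [← Real.exp_nat_mul]; norm_num
      rw [h2]
      calc (41 : ℝ) ≤ 2.7 ^ 4 := by norm_num
        _ ≤ _ := pow_le_pow_left₀ (by norm_num) (by linarith) 4
    have h1 : Real.log (n / R) ≤ Real.log (41 * (n / M)) := by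
      apply Real.log_le_log (by positivity)
      rw [div_le_iff₀ hR0]
      have : 41 * (n / M) * R = n * (41 * R / M) := by ring
      rw [this]
      refine le_mul_of_one_le_right hn0.le ?_
      rw [le_div_iff₀ hM0]; linarith
    rw [Real.log_mul (by norm_num) (by positivity)] at h1
    linarith
  have hhm : (0 : ℝ) ≤ h * m := by positivity
  rw [hbC, hbM]
  constructor
  · calc (h : ℝ) * m * M * max 1 (Real.log (n / M))
        ≤ h * m * (41 * R) * max 1 (Real.log (n / R)) := by gcongr
      _ = _ := by ring
  · have h5 : max 1 (Real.log (n / R)) ≤ 5 * max 1 (Real.log (n / M)) := by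
      have h6 := le_max_left 1 (Real.log (n / M))
      have h7 := le_max_right 1 (Real.log (n / M))
      refine max_le (by linarith) (by linarith)
    calc (h : ℝ) * m * R * max 1 (Real.log (n / R))
        ≤ h * m * M * (5 * max 1 (Real.log (n / M))) := by gcongr
      _ = _ := by ring

theorem boundM_nonneg {n m h : ℕ} {ε C : ℝ} (hε : 0 < ε) (hC : 0 < C) :
    0 ≤ boundM n m h ε C := by
  have := (le_buffer hε hC).2
  unfold boundM
  positivity

/-- A level that only few nodes reach and that is logarithmic in `n / M`. -/
theorem exists_level {n : ℕ} {M : ℝ} (hn : 1 ≤ n) (hM : 1 ≤ M) :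
    ∃ κ : ℕ, (n : ℝ) * (1 / 2) ^ κ ≤ M / 4 ∧
      (κ : ℝ) + 1 ≤ 6 * max 1 (Real.log (n / M)) := by
  have hM0 : 0 < M := by linarith
  have hn0 : (0 : ℝ) < n := by exact_mod_cast hn
  have hex : ∃ k : ℕ, 4 * (n : ℝ) ≤ M * 2 ^ k := by
    obtain ⟨k, hk⟩ := pow_unbounded_of_one_lt (4 * (n : ℝ)) (one_lt_two (α := ℝ))
    exact ⟨k, hk.le.trans (le_mul_of_one_le_left (by positivity) hM)⟩
  classical
  refine ⟨Nat.find hex, ?_, ?_⟩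
  · have h := Nat.find_spec hex
    have h2 : (0 : ℝ) < 2 ^ Nat.find hex := by positivity
    rw [one_div, inv_pow, ← div_eq_mul_inv, div_le_iff₀ h2]
    linarith
  · have hx := le_max_left 1 (Real.log (n / M))
    have hx' := le_max_right 1 (Real.log (n / M))
    rcases hk : Nat.find hex with _ | k
    · simp; linarith
    -- Minimality gives `2 ^ (κ - 1) < 4 n / M`; taking logarithms bounds `κ`.
    · have h := Nat.find_min hex (m := k) (by omega)
      rw [not_le] at h
      have h1 : (2 : ℝ) ^ k ≤ 2 ^ 2 * (n / M) := by
        rw [← mul_div_assoc, le_div_iff₀ hM0]; linarith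
      have h2 := Real.log_le_log (by positivity) h1
      rw [Real.log_mul (by norm_num) (by positivity), Real.log_pow, Real.log_pow] at h2
      have hl2 := Real.log_two_gt_d9
      have hl3 := Real.log_two_lt_d9
      have h3 : (k : ℝ) * 0.69 ≤ k * Real.log 2 := by gcongr; linarith
      push_cast at h2 ⊢
      linarith

/-! ### The running time as a random variable -/

theorem sum_length_adj {G : SimpleGraph (Fin n)} [DecidableRel G.Adj] {adj : Fin n → List (Fin n)}
    (hadj : IsAdjList G adj) : ∑ v, (adj v).length = 2 * G.edgeFinset.card := by
  rw [← G.sum_degrees_eq_twice_card_edges]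
  refine Finset.sum_congr rfl fun v _ => ?_
  rw [← List.toFinset_card_of_nodup (hadj v).1, ← G.card_neighborFinset_eq_degree]
  congr 1
  ext w
  simp [(hadj v).2 w]

/-- The constant is `300 · 2 · 6`: the degrees add up to twice the number of edges, and `κ + 1` is
at most six times the logarithmic factor. -/
theorem coreTime_le {G : SimpleGraph (Fin n)} [DecidableRel G.Adj] {adj : Fin n → List (Fin n)}
    {h : ℕ} {ε C : ℝ} (hadj : IsAdjList G adj) (hn : 1 ≤ n) (hm : n ≤ 2 * G.edgeFinset.card)
    (hh : 1 ≤ h) (hM : 1 ≤ buffer ε C) {κ : ℕ}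
    (hκ : (κ : ℝ) + 1 ≤ 6 * max 1 (Real.log (n / buffer ε C))) {r : Fin n → ℕ}
    (hr : (Finset.univ.filter fun x => κ ≤ r x).card ≤ ⌊buffer ε C⌋₊) :
    (coreTime adj h ε C r : ℝ) ≤ 3600 * boundM n G.edgeFinset.card h ε C := by
  set P : Input n := { adj := adj, h := h, M := buffer ε C, r := r } with hP
  have hV : P.Valid := by
    refine ⟨fun v w hw => ?_, fun v => (hadj v).1, ?_⟩
    · exact ((hadj w).2 v).2 (((hadj v).2 w).1 hw).symm
    · exact (Nat.one_le_floor_iff _).2 hM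
  have h1 := time_core_le hV (κ := κ) hr hn (by rw [sum_length_adj hadj]; exact hm) hh
  rw [sum_length_adj hadj] at h1
  have h2 : ((core P).time : ℝ) ≤ 300 * (h * P.cap * (2 * G.edgeFinset.card) * (κ + 1)) := by
    exact_mod_cast h1
  have h3 : (P.cap : ℝ) ≤ buffer ε C := Nat.floor_le (by linarith)
  refine h2.trans ?_
  calc (300 : ℝ) * (h * P.cap * (2 * G.edgeFinset.card) * (κ + 1))
      ≤ 300 * (h * buffer ε C * (2 * G.edgeFinset.card) *
        (6 * max 1 (Real.log (n / buffer ε C)))) := by gcongr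
    _ = 3600 * boundM n G.edgeFinset.card h ε C := by unfold boundM; ring

theorem prob_coreTime_le {G : SimpleGraph (Fin n)} [DecidableRel G.Adj]
    {adj : Fin n → List (Fin n)} {h : ℕ} {ε C : ℝ} (hadj : IsAdjList G adj) (hn : 1 ≤ n)
    (hm : n ≤ 2 * G.edgeFinset.card) (hh : 1 ≤ h) (hε : 0 < ε) (hε' : ε ≤ 1 / 2) (hC : 0 < C) :
    1 - n * Real.exp (-C) ≤ (rankMeasure n).real
      {r | (coreTime adj h ε C r : ℝ) ≤ 3600 * boundM n G.edgeFinset.card h ε C} := by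
  obtain ⟨hMR, hM⟩ := le_buffer hε hC
  obtain ⟨κ, hκ, hκ'⟩ := exists_level hn hM
  set M := buffer ε C with hMdef
  set bad := {r : Fin n → ℕ | ⌊M⌋₊ < (Finset.univ.filter fun x => κ ≤ r x).card} with hbad
  have hprob : (rankMeasure n).real bad ≤ Real.exp (-C) := by
    have h1 := rankMeasure_card_gt_le n ⌊M⌋₊ κ
    have h2 : Real.exp (M * Real.log 2) ≤ 2 ^ (⌊M⌋₊ + 1) := by
      rw [mul_comm, Real.exp_mul, Real.exp_log two_pos, ← Real.rpow_natCast]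
      refine Real.rpow_le_rpow_of_exponent_le (by norm_num) ?_
      push_cast
      exact (Nat.lt_floor_add_one M).le
    have h3 : Real.exp (M * Real.log 2) * (rankMeasure n).real bad ≤ Real.exp (M / 4) :=
      (mul_le_mul_of_nonneg_right h2 measureReal_nonneg).trans
        (h1.trans (Real.exp_le_exp.2 hκ))
    have h4 : (rankMeasure n).real bad ≤ Real.exp (M / 4 - M * Real.log 2) := by
      rw [Real.exp_sub, le_div_iff₀ (Real.exp_pos _), mul_comm]
      exact h3
    refine h4.trans (Real.exp_le_exp.2 ?_)
    -- Since `M ≥ 8 C / ε² ≥ 32 C` and `log 2 - 1 / 4 > 0.4`, the exponent is far below `-C`; the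
    -- factor `n` in the claim is not needed for this bound.
    have h5 := le_div_sq hε hε' hC
    nlinarith [Real.log_two_gt_d9]
  have hcompl : (rankMeasure n).real badᶜ = 1 - (rankMeasure n).real bad :=
    probReal_compl_eq_one_sub MeasurableSet.of_discrete
  have hsub : badᶜ ⊆ {r | (coreTime adj h ε C r : ℝ) ≤
      3600 * boundM n G.edgeFinset.card h ε C} := by
    intro r hr
    simp only [hbad, Set.mem_compl_iff, Set.mem_ofPred_eq, not_lt] at hr
    exact coreTime_le hadj hn hm hh hM hκ' hr
  have hmono := measureReal_mono (μ := rankMeasure n) hsub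
  have hn1 : (1 : ℝ) ≤ n := by exact_mod_cast hn
  have := le_mul_of_one_le_left (Real.exp_pos (-C)).le hn1
  linarith

end DistCore

theorem proposition7 :
    ∃ K : ℝ, 0 < K ∧
      ∀ (n : ℕ) (G : SimpleGraph (Fin n)) [DecidableRel G.Adj] (adj : Fin n → List (Fin n))
        (h : ℕ) (ε C : ℝ),
        DistCore.IsAdjList G adj → 1 ≤ n → n ≤ 2 * G.edgeFinset.card → 1 ≤ h →
        0 < ε → ε ≤ 1 / 2 → 0 < C →
        1 - n * Real.exp (-C) ≤ (DistCore.rankMeasure n).real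
          {r | (DistCore.coreTime adj h ε C r : ℝ)
            ≤ K * DistCore.boundM n G.edgeFinset.card h ε C} ∧
        1 - n * Real.exp (-C) ≤ (DistCore.rankMeasure n).real
          {r | (DistCore.coreTime adj h ε C r : ℝ)
            ≤ K * DistCore.boundC n G.edgeFinset.card h ε C} ∧
        (Real.log 2 ≤ C →
          DistCore.boundM n G.edgeFinset.card h ε C
              ≤ K * DistCore.boundC n G.edgeFinset.card h ε C ∧
          DistCore.boundC n G.edgeFinset.card h ε C
              ≤ K * DistCore.boundM n G.edgeFinset.card h ε C) := by
  -- The factor `41` converts `boundM` into `boundC` when `C ≥ log 2`.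
  refine ⟨3600 * 41, by norm_num, fun n G _ adj h ε C hadj hn hm hh hε hε' hC => ?_⟩
  have hmain := DistCore.prob_coreTime_le hadj hn hm hh hε hε' hC
  have hM0 := DistCore.boundM_nonneg (n := n) (m := G.edgeFinset.card) (h := h) hε hC
  refine ⟨hmain.trans (measureReal_mono fun r hr => ?_), ?_, fun hC2 => ?_⟩
  · rw [Set.mem_ofPred_eq] at hr ⊢
    linarith
  · rcases le_or_gt (Real.log 2) C with hC2 | hC2
    · have hequiv := DistCore.bounds_equiv (m := G.edgeFinset.card) (h := h) hn hε hε' hC2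
      refine hmain.trans (measureReal_mono fun r hr => ?_)
      rw [Set.mem_ofPred_eq] at hr ⊢
      linarith [hequiv.1]
    -- For `C < log 2` the claim is void: `n ≤ 2 m` forces an edge, so `n ≥ 2` and `n exp (-C) ≥ 1`.
    · have hn2 : 2 ≤ n := by
        by_contra hlt
        have h1 : n = 1 := by omega
        subst h1
        have := G.card_edgeFinset_le_card_choose_two
        rw [Fintype.card_fin, show Nat.choose 1 2 = 0 from rfl] at this
        omega
      have h1 : Real.exp (-Real.log 2) ≤ Real.exp (-C) := Real.exp_le_exp.2 (by linarith)
      rw [Real.exp_neg, Real.exp_log two_pos] at h1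
      have h2 : (2 : ℝ) ≤ n := by exact_mod_cast hn2
      have h3 : (1 : ℝ) ≤ n * Real.exp (-C) := by nlinarith
      exact (by linarith : 1 - n * Real.exp (-C) ≤ 0).trans measureReal_nonneg
  · have hequiv := DistCore.bounds_equiv (m := G.edgeFinset.card) (h := h) hn hε hε' hC2
    constructor <;> linarith [hequiv.1, hequiv.2]
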